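/- Let $M$ be a smooth manifold of dimension $n$ (without boundary, not necessarily compact) and let $(h,X)$ be a Morse–Smale pair on $M$: $h:M\to\mathbb R$ is a smooth proper Morse function and $X$ is a smooth complete vector field with flow $\Phi_t$ such that $X(h)<0$ off the set $\mathrm{Crit}(h)$ of critical points; every $v\in\mathrm{Crit}(h)$, of index $i(v)$, is the centre of a smooth chart onto a ball $B_r(0)\subset\mathbb R^n$ in which $h=h(v)-\frac12\sum_{j\le i(v)}x_j^2+\frac12\sum_{j>i(v)}x_j^2$ and $X=\sum_{j\le i(v)}x_j\partial_{x_j}-\sum_{j>i(v)}x_j\partial_{x_j}$; and for all $v,w\in\mathrm{Crit}(h)$ the manifolds $W^-_v$ and $W^+_w$ intersect transversally, where $W^\pm_v=\{x\in M:\lim_{t\to\pm\infty}\Phi_t(x)=v\}$. For $v,w\in\mathrm{Crit}(h)$ write $w<v$ if $i(w)<i(v)$ and $h(w)<h(v)$, and $w\le v$ if $w<v$ or $w=v$. For $w<v$ let $\mathcal T(v,w)=(W^-_v\cap W^+_w)/\mathbb R$ be the set of flow orbits in $W^-_v\cap W^+_w$, put $$\mathcal B(v,w)=\bigsqcup_{w<v_\ell<\dots<v_1<v}\mathcal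 T(v,v_1)\times\dots\times\mathcal T(v_\ell,w)\quad(\ell\ge0),\qquad \mathcal B(v,v)=\{v\},\qquad \hat W^-_v=\bigsqcup_{w\le v}\mathcal B(v,w)\times W^-_w,$$ and let $\hat i_v:\hat W^-_v\to M$, $(\gamma,x)\mapsto x$, and $\hat h_v=h\circ\hat i_v$. An element $\gamma\in\mathcal B(v,w)$, respectively $(\gamma,x)\in\hat W^-_v$, is a possibly broken trajectory from $v$ to $w$, respectively to $x$; let $\gamma(s)$, respectively $\gamma_x(s)$, denote its unique point on the level $h=s$, for $h(w)\le s\le h(v)$, respectively $h(x)\le s\le h(v)$. Topologies. For a critical value $c$ of $h$ let $c_-<c<c_+$ be the neighbouring critical values, with $c_-=-\infty$ or $c_+=+\infty$ if there is none. Choose positive numbers $\varepsilon_c,\delta_c$, one for each critical value $c$, with $2\varepsilon_c<c-c_-$, $2\delta_c<\min(c-c_-,\,c_+-c)$ and, if $c_-$ is finite, $\varepsilon_c\le\delta_{c_-}$. Give $\mathcal B(v,w)$, $w<v$, the topology induced by the map $\gamma\mapsto(\gamma(c-\varepsilon_c))_c$ into a product of copies of $M$, where $c$ runs over the critical values with $h(w)<c\le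 h(v)$ (here only the first condition on the $\varepsilon_c$ is needed). For each critical value $c\le h(v)$ give $\hat W^-_{v,c}=\{p\in\hat W^-_v: c_-+\delta_c\le\hat h_v(p)\le c_+-\delta_c\}$ the topology induced by $(\gamma,x)\mapsto\big((\gamma_x(c'-\varepsilon_{c'}))_{c'},x\big)$, where $c'$ runs over the critical values with $c<c'\le h(v)$, and give $\hat W^-_v$ the topology defined by its covering by the sets $\hat W^-_{v,c}$: a subset is open iff its intersection with each $\hat W^-_{v,c}$ is open in $\hat W^-_{v,c}$. Theorem. Such numbers $\varepsilon_c,\delta_c$ exist, and the topologies of $\mathcal B(v,w)$ and $\hat W^-_v$ do not depend on their choice. Moreover: (i) For all $v,w\in\mathrm{Crit}(h)$ with $w<v$, $\mathcal B(v,w)$ is a compact Hausdorff space. (ii) For every $v\in\mathrm{Crit}(h)$, $\hat W^-_v$ is a Hausdorff space and both $\hat i_v:\hat W^-_v\to M$ and $\hat h_v:\hat W^-_v\to\mathbb R$ are continuous and proper (preimages of compact sets are compact). In particular, if $M$ is compact, then so is $\hat W^-_v$. -/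

import Mathlib

open Set Filter Topology
open scoped Manifold ContDiff

noncomputable section

/-- The space `ℝⁿ` on which the manifolds below are modelled. -/
abbrev Rn (n : ℕ) : Type := EuclideanSpace ℝ (Fin n)

/-- The standard Morse function `-‖x⁻‖² / 2 + ‖x⁺‖² / 2` on `ℝⁿ = ℝᵏ × ℝⁿ⁻ᵏ`. -/
def modelFun {n : ℕ} (k : ℕ) (x : Rn n) : ℝ :=
  -(1 / 2) * (∑ j ∈ Finset.univ.filter (fun j : Fin n => (j : ℕ) < k), x j ^ 2) +
    (1 / 2) * (∑ j ∈ Finset.univ.filter (fun j : Fin n => k ≤ (j : ℕ)), x j ^ 2)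

/-- The standard vector field `(x⁻, -x⁺)` on `ℝⁿ = ℝᵏ × ℝⁿ⁻ᵏ`. -/
def modelField {n : ℕ} (k : ℕ) (x : Rn n) : Rn n :=
  WithLp.toLp 2 fun j => if (j : ℕ) < k then x j else -x j

section Morse

variable {n : ℕ} {M : Type*} [TopologicalSpace M] [ChartedSpace (Rn n) M]

/-- `v` is a critical point of `h` if the differential `d_v h` vanishes. -/
def IsCritical (h : M → ℝ) (v : M) : Prop := mvfderiv (𝓡 n) h v = 0

/-- The second derivative of `h` at `v`, read in the preferred chart at `v` (`T_v M` is identified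
with `ℝⁿ` through this same chart). At a critical point this is the Hessian `d²_v h`. -/
def hessian (h : M → ℝ) (v : M) : Rn n →L[ℝ] Rn n →L[ℝ] ℝ :=
  fderiv ℝ (fderiv ℝ (h ∘ (extChartAt (𝓡 n) v).symm)) (extChartAt (𝓡 n) v v)

/-- The index `i(v)`: the maximal dimension of a subspace on which the Hessian is negative
definite. -/
def morseIndex (h : M → ℝ) (v : M) : ℕ :=
  sigNeg
    (LinearMap.BilinMap.toQuadraticMap (hessian (n := n) h v).toLinearMap₁₂)

/-- All critical points of `h` are nondegenerate. -/
def IsMorse (h : M → ℝ) : Prop :=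
  ∀ v : M, IsCritical (n := n) h v →
    ∀ ξ : Rn n, (∀ η : Rn n, hessian h v ξ η = 0) → ξ = 0

/-- Velocities at time `0` of curves through `x` that stay in `W` near time `0`. For an embedded
submanifold `W` and `x ∈ W` this is the tangent space `T_x W`. -/
def tangentVectors (W : Set M) (x : M) : Set (TangentSpace (𝓡 n) x) :=
  {ξ | ∃ c : ℝ → M, c 0 = x ∧ (∀ᶠ t in 𝓝 (0 : ℝ), c t ∈ W) ∧
    HasMFDerivAt 𝓘(ℝ, ℝ) (𝓡 n) c 0
      ((1 : ℝ →L[ℝ] ℝ).smulRight (ξ : Rn n) : ℝ →L[ℝ] Rn n)}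

/-- `T_x M` is spanned by `T_x W ∪ T_x W'` at every `x ∈ W ∩ W'`. -/
def TransverseSets (W W' : Set M) : Prop :=
  ∀ x ∈ W ∩ W', Submodule.span ℝ (tangentVectors (n := n) W x ∪ tangentVectors W' x) = ⊤

/-- The set of points `x` whose `X`-trajectory `c` (with `c 0 = x`) is defined for all times and
tends to `v` along the filter `l`. -/
def limitSet (X : (x : M) → TangentSpace (𝓡 n) x) (l : Filter ℝ) (v : M) : Set M :=
  {x | ∃ c : ℝ → M, c 0 = x ∧ IsMIntegralCurve c X ∧ Tendsto c l (𝓝 v)}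

/-- The unstable set `W⁻_v`. -/
def unstableSet (X : (x : M) → TangentSpace (𝓡 n) x) (v : M) : Set M := limitSet X atBot v

/-- The stable set `W⁺_v`. -/
def stableSet (X : (x : M) → TangentSpace (𝓡 n) x) (v : M) : Set M := limitSet X atTop v

/-- The vector field `X` is gradient-like with respect to `h`: `X(h) < 0` away from the
critical points, and every critical point `v` is the centre of a smooth chart with image a
ball, in which `h` and `X` take the standard form of index `i(v)`. -/
structure IsGradientLike (h : M → ℝ) (X : (x : M) → TangentSpace (𝓡 n) x) : Prop where
  neg : ∀ x : M, ¬ IsCritical (n := n) h x → mvfderiv (𝓡 n) h x (X x) < 0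
  standard : ∀ v : M, IsCritical (n := n) h v →
    ∃ e ∈ IsManifold.maximalAtlas (𝓡 n) ∞ M, ∃ r > 0,
      v ∈ e.source ∧ e v = 0 ∧ e.target = Metric.ball 0 r ∧
      ∀ y ∈ e.source,
        h y = h v + modelFun (morseIndex (n := n) h v) (e y) ∧
        mvfderiv (𝓡 n) e y (X y) = modelField (morseIndex (n := n) h v) (e y)

end Morse

/-- A Morse–Smale pair `(h, X)` on `M`: a smooth proper Morse function `h` and a smooth complete
vector field `X` which is gradient-like with respect to `h` and satisfies the Morse–Smale
condition. -/
structure MorseSmalePair (n : ℕ) (M : Type*) [TopologicalSpace M] [ChartedSpace (Rn n) M]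
    [IsManifold (𝓡 n) ∞ M] where
  h : M → ℝ
  X : (x : M) → TangentSpace (𝓡 n) x
  smooth_h : ContMDiff (𝓡 n) 𝓘(ℝ, ℝ) ∞ h
  proper_h : IsProperMap h
  morse : IsMorse (n := n) h
  smooth_X : ContMDiff (𝓡 n) (𝓡 n).tangent ∞ fun x => (⟨x, X x⟩ : TangentBundle (𝓡 n) M)
  complete : ∀ x : M, ∃ c : ℝ → M, c 0 = x ∧ IsMIntegralCurve c X
  gradientLike : IsGradientLike h X
  morseSmale : ∀ v w : M, IsCritical (n := n) h v → IsCritical (n := n) h w →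
    TransverseSets (n := n) (unstableSet X v) (stableSet X w)

namespace MorseSmalePair

universe u

variable {n : ℕ} {M : Type u} [TopologicalSpace M] [ChartedSpace (Rn n) M]
  [IsManifold (𝓡 n) ∞ M] (P : MorseSmalePair n M)

/-- The flow `Φ_t(x)` of `X`. -/
def flow (t : ℝ) (x : M) : M := (P.complete x).choose t

/-- The set of critical points of `h`. -/
def Crit : Type u := {v : M // IsCritical (n := n) P.h v}

/-- The set of critical values of `h`. -/
def critValues : Set ℝ := P.h '' {v | IsCritical (n := n) P.h v}

variable {P}

/-- The value `h(v)` at a critical point. -/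
def Crit.val (v : P.Crit) : ℝ := P.h v.1

/-- The index `i(v)` of a critical point. -/
def Crit.index (v : P.Crit) : ℕ := morseIndex (n := n) P.h v.1

/-- `w < v` iff `i(w) < i(v)` and `h(w) < h(v)`. -/
def Crit.Below (w v : P.Crit) : Prop := w.index < v.index ∧ w.val < v.val

variable (P)

/-- The unstable manifold `W⁻_v`. -/
def Wminus (v : P.Crit) : Set M := unstableSet P.X v.1

/-- The stable manifold `W⁺_v`. -/
def Wplus (v : P.Crit) : Set M := stableSet P.X v.1

/-- The orbit of a point under the flow. -/
def orbit (x : M) : Set M := range fun t : ℝ => P.flow t x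

/-- The space `𝒯(v, w) = (W⁻_v ∩ W⁺_w) / ℝ` of unbroken trajectories, as the set of flow orbits in
`W⁻_v ∩ W⁺_w`. -/
def Traj (v w : P.Crit) : Set (Set M) := P.orbit '' (P.Wminus v ∩ P.Wplus w)

/-- The set `ℬ(v, w)` of possibly broken trajectories from `v` to `w`: the disjoint union of
`𝒯(v, v₁) × 𝒯(v₁, v₂) × ⋯ × 𝒯(v_ℓ, w)` over all chains `w < v_ℓ < ⋯ < v₁ < v`, `ℓ ≥ 0`, if
`w < v`; a one-point set if `v = w`; and empty otherwise. -/
inductive Broken : P.Crit → P.Crit → Type u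
  | const (v : P.Crit) : Broken v v
  | step {v v₁ w : P.Crit} (hlt : v₁.Below v) (γ : P.Traj v v₁) (β : Broken v₁ w) : Broken v w

variable {P}

/-- The subset of `M` traced out by a broken trajectory, including the critical points `v`,
`v₁, …, v_ℓ`, `w` that it connects. -/
def Broken.trace : {v w : P.Crit} → P.Broken v w → Set M
  | _, _, .const v => {v.1}
  | _, _, .step (v := v) _ γ β => insert v.1 (γ.1 ∪ β.trace)

variable (P)

/-- The set `Ŵ⁻_v`, the disjoint union of `ℬ(v, w) × W⁻_w` over the critical points `w ≤ v`. -/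
def Hat (v : P.Crit) : Type u :=
  Σ w : {w : P.Crit // w.Below v ∨ w = v}, P.Broken v w.1 × P.Wminus w.1

variable {P}

/-- The map `î_v : Ŵ⁻_v → M`, `(γ, x) ↦ x`. -/
def hatI (v : P.Crit) (p : P.Hat v) : M := p.2.2.1

/-- The map `ĥ_v = h ∘ î_v`. -/
def hatH (v : P.Crit) : P.Hat v → ℝ := P.h ∘ hatI v

/-- The subset of `M` traced out by the broken trajectory `γ_x` from `v` to `x` given by an element
`(γ, x)` of `Ŵ⁻_v`: the trace of `γ`, followed by the part of the orbit of `x` up to `x`. -/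
def hatTrace (v : P.Crit) (p : P.Hat v) : Set M :=
  p.2.1.trace ∪ (fun t : ℝ => P.flow t p.2.2.1) '' Iic 0

open Classical in
/-- The point of the trace `S` of a trajectory starting at `v` on the level `h = s`, that is the
value `γ(s)` of the parametrization with `h (γ(s)) = s` (with value `v` if there is none, which
does not occur for `s` between the levels of the endpoints). -/
def pointAt (v : P.Crit) (S : Set M) (s : ℝ) : M :=
  if H : ∃ y ∈ S, P.h y = s then H.choose else v.1

/-- The map `J_ε : γ ↦ (γ(c - ε_c))_c`, with `c` ranging over the critical values in
`(h(w), h(v)]`. -/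
def J (ε : ℝ → ℝ) (v w : P.Crit) (γ : P.Broken v w) :
    {c : ℝ // c ∈ P.critValues ∧ w.val < c ∧ c ≤ v.val} → M :=
  fun c => pointAt v γ.trace (c.1 - ε c.1)

/-- The topology of `ℬ(v, w)`: it is identified, through `J_ε`, with a subspace of a product of
copies of `M` (or of level sets of `h`). -/
@[reducible] def brokenTopology (ε : ℝ → ℝ) (v w : P.Crit) : TopologicalSpace (P.Broken v w) :=
  TopologicalSpace.induced (J ε v w) inferInstance

/-- For a critical value `c`, with neighbouring critical values `c_- < c < c_+`, the piece
`ĥ_v⁻¹ [c_- + δ_c, c_+ - δ_c]` of `Ŵ⁻_v`; an endpoint is omitted if `c_-` or `c_+` does not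
exist. -/
def hatPiece (δ : ℝ → ℝ) (v : P.Crit) (c : ℝ) : Set (P.Hat v) :=
  {p | ∀ c' ∈ P.critValues,
    (c' < c → c' + δ c ≤ hatH v p) ∧ (c < c' → hatH v p ≤ c' - δ c)}

/-- The map `Ĵ_{ε,c} : (γ, x) ↦ ((γ_x(c' - ε_{c'}))_{c'}, x)` on the piece belonging to `c`, with
`c'` ranging over the critical values in `(c, h(v)]`. -/
def hatJ (ε δ : ℝ → ℝ) (v : P.Crit) (c : ℝ) (p : hatPiece δ v c) :
    ({c' : ℝ // c' ∈ P.critValues ∧ c < c' ∧ c' ≤ v.val} → M) × M :=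
  (fun c' => pointAt v (hatTrace v p.1) (c'.1 - ε c'.1), hatI v p.1)

/-- The topology of a piece of `Ŵ⁻_v`: it is identified with a subspace through `Ĵ_{ε,c}`. -/
@[reducible] def pieceTopology (ε δ : ℝ → ℝ) (v : P.Crit) (c : ℝ) : TopologicalSpace (hatPiece δ v c) :=
  TopologicalSpace.induced (hatJ ε δ v c) inferInstance

/-- The topology of `Ŵ⁻_v` defined by its covering by pieces: a set is open iff its intersection
with every piece, for the critical values `c ≤ h(v)`, is open in that piece. -/
@[reducible] def hatTopology (ε δ : ℝ → ℝ) (v : P.Crit) : TopologicalSpace (P.Hat v) :=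
  ⨆ c : {c : ℝ // c ∈ P.critValues ∧ c ≤ v.val},
    TopologicalSpace.coinduced Subtype.val (pieceTopology ε δ v c.1)

variable (P)

/-- The numbers `ε_c > 0` are so small that `c - 2 ε_c` lies above the next lower critical
value. -/
def AdmissibleEps (ε : ℝ → ℝ) : Prop :=
  ∀ c ∈ P.critValues, 0 < ε c ∧ ∀ c' ∈ P.critValues, c' < c → c' < c - 2 * ε c

/-- The numbers `δ_c > 0` are smaller than half the distance from `c` to the neighbouring critical
values. -/
def AdmissibleDelta (δ : ℝ → ℝ) : Prop :=
  ∀ c ∈ P.critValues, 0 < δ c ∧ ∀ c' ∈ P.critValues, c' ≠ c → δ c < (1 / 2) * |c - c'|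

/-- `ε` and `δ` are admissible, and the level `c - ε_c` used for a critical value `c` is not below
the piece `[c_- + δ, c - δ_{c'}]` of the next lower critical value `c'`, so that it is met by all
the trajectories `γ_x` that end in that piece. -/
def Admissible (ε δ : ℝ → ℝ) : Prop :=
  P.AdmissibleEps ε ∧ P.AdmissibleDelta δ ∧
    ∀ c ∈ P.critValues, ∀ c' ∈ P.critValues, c' < c →
      (∀ c'' ∈ P.critValues, ¬ (c' < c'' ∧ c'' < c)) → ε c ≤ δ c'

end MorseSmalePair

end

/-! An element of `Hat v` is best seen as a path parametrised by the level: to `s` belongs the point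
of the trajectory on the level `max s (hatH v p)`, so that below the level of its end point the path
waits there (`pathPoint`). End point and path together embed `Hat v` in `M × (ℝ → M)`. The induced
topology of pointwise convergence, `pathTopology`, involves no choices. The theorem reduces to two
facts: the topologies built from `ε` and `δ` agree with this one, and `hatI` is proper for it.

The analytic core is `IsLyapunov.tendsto_of_conn`. Take a flow with a proper strict Lyapunov
function and finitely many rest points between any two levels. The point where the trajectory
through a given point meets a given level depends continuously on both, up to and including the
neighbouring critical levels, where it may be reached only in infinite time. Hence one regular level
`c - ε c` in each gap between critical values controls all levels of the closed gap. This yields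
`brokenTopology_eq` and, piece by piece, `hatTopology_eq`.

For properness, take an ultrafilter on `Hat v` whose end points converge to `y`. As `h` is proper,
the trajectories converge pointwise to a path `g` over the levels from `h y` to `h v`. By
continuity, points of `g` not separated by a critical level are linked by the flow, and
`exists_hat_of_conn` reads off a broken trajectory. Here the Morse–Smale condition enters: the limit
orbits join critical points, and such an orbit must lower the index (`below_of_mem`). That is a
dimension count in the standard charts, carried along the orbit by the derivative of the flow; hence
the initial sections on differentiability in the initial value.

Finally `Broken v w` is the fibre of `hatI` over `w`, hence compact, and `hatH` is the composite of
two proper maps. -/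

noncomputable section

/-! ### Local flows of `C²` vector fields on Banach spaces -/

section LocalFlow

variable {E : Type*} [NormedAddCommGroup E] [NormedSpace ℝ E]

/-- First-order Taylor estimate for a function with Lipschitz derivative on a convex set. -/
theorem Convex.norm_sub_sub_fderiv_le {f : E → E} {s : Set E} (hs : Convex ℝ s)
    {f' : E → E →L[ℝ] E} {K : NNReal} (hf : ∀ x ∈ s, HasFDerivAt f (f' x) x)
    (hK : LipschitzOnWith K f' s) {x y : E} (hx : x ∈ s) (hy : y ∈ s) :
    ‖f y - f x - f' x (y - x)‖ ≤ K * ‖y - x‖ ^ 2 := by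
  have hseg : segment ℝ x y ⊆ s := hs.segment_subset hx hy
  have := (convex_segment x y).norm_image_sub_le_of_norm_hasFDerivWithin_le' (f := f) (f' := f')
    (φ := f' x) (C := K * ‖y - x‖) (fun z hz => (hf z (hseg hz)).hasFDerivWithinAt) (fun z hz => by
      have h1 := hK.dist_le_mul z (hseg hz) x hx
      rw [dist_eq_norm, dist_eq_norm] at h1
      refine h1.trans (mul_le_mul_of_nonneg_left ?_ K.2)
      have := norm_sub_le_of_mem_segment hz
      simpa using this) (left_mem_segment ℝ x y) (right_mem_segment ℝ x y)
  rw [pow_two, ← mul_assoc]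
  exact this

/-- A family of solutions of an autonomous ODE is differentiable in the initial value, with
derivative the solution of the linearised equation. -/
theorem hasFDerivAt_of_linearised_nonneg {f : E → E} {s : Set E} (hs : Convex ℝ s)
    (hso : IsOpen s) {f' : E → E →L[ℝ] E} {K K₂ : NNReal}
    (hf : ∀ x ∈ s, HasFDerivAt f (f' x) x) (hK : LipschitzOnWith K f s)
    (hK₂ : LipschitzOnWith K₂ f' s) {U : Set E} (hU : IsOpen U) {τ : ℝ}
    {β : E → ℝ → E} {Y : E → ℝ → E →L[ℝ] E}
    (hβ0 : ∀ x ∈ U, β x 0 = x) (hβs : ∀ x ∈ U, ∀ t ∈ Ioo (-τ) τ, β x t ∈ s)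
    (hβ : ∀ x ∈ U, ∀ t ∈ Ioo (-τ) τ, HasDerivAt (β x) (f (β x t)) t)
    (hY0 : ∀ x ∈ U, Y x 0 = ContinuousLinearMap.id ℝ E)
    (hY : ∀ x ∈ U, ∀ t ∈ Ioo (-τ) τ, HasDerivAt (Y x) ((f' (β x t)).comp (Y x t)) t)
    {x : E} (hx : x ∈ U) {t : ℝ} (ht0 : 0 ≤ t) (htτ : t < τ) :
    HasFDerivAt (fun y => β y t) (Y x t) x := by
  have hsub : Icc 0 t ⊆ Ioo (-τ) τ := fun r hr => ⟨by linarith [hr.1], by linarith [hr.2]⟩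
  have hcont : ContinuousOn (β x) (Icc 0 t) := fun r hr =>
    (hβ x hx r (hsub hr)).continuousAt.continuousWithinAt
  have hYc : ContinuousOn (Y x) (Icc 0 t) := fun r hr =>
    (hY x hx r (hsub hr)).continuousAt.continuousWithinAt
  obtain ⟨C, hC⟩ := isCompact_Icc.exists_bound_of_continuousOn hYc
  have hC0 : 0 ≤ C := (norm_nonneg _).trans (hC 0 ⟨le_rfl, ht0⟩)
  -- A uniform neighbourhood of the compact trajectory lies in `s`, so the first-order
  -- approximations below stay where the Lipschitz bounds hold.
  obtain ⟨δ, hδ, hδs⟩ := (isCompact_Icc.image_of_continuousOn hcont).exists_thickening_subset_open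
    hso (by rintro _ ⟨r, hr, rfl⟩; exact hβs x hx r (hsub hr))
  have hin : ∀ r ∈ Icc 0 t, ∀ η : E, ‖η‖ < δ → β x r + η ∈ s := fun r hr η hη =>
    hδs (Metric.mem_thickening_iff.2 ⟨β x r, mem_image_of_mem _ hr, by simpa using hη⟩)
  have key : ∀ᶠ y in 𝓝 x, ‖β y t - β x t - Y x t (y - x)‖ ≤
      gronwallBound 0 K (K₂ * C ^ 2) t * ‖y - x‖ ^ 2 := by
    have h1 : ∀ᶠ y in 𝓝 x, C * ‖y - x‖ < δ := by
      have : Tendsto (fun y : E => C * ‖y - x‖) (𝓝 x) (𝓝 (C * ‖x - x‖)) :=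
        Continuous.tendsto (by fun_prop) x
      simp only [sub_self, norm_zero, mul_zero] at this
      exact this.eventually (gt_mem_nhds hδ)
    filter_upwards [h1, hU.mem_nhds hx] with y hy hyU
    have hη : ∀ r ∈ Icc 0 t, ‖Y x r (y - x)‖ ≤ C * ‖y - x‖ := fun r hr =>
      ((Y x r).le_opNorm _).trans (mul_le_mul_of_nonneg_right (hC r hr) (norm_nonneg _))
    have hz : ∀ r ∈ Icc 0 t, β x r + Y x r (y - x) ∈ s := fun r hr =>
      hin r hr _ ((hη r hr).trans_lt hy)
    have hzd : ∀ r ∈ Icc 0 t, HasDerivAt (fun r => β x r + Y x r (y - x))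
        (f (β x r) + f' (β x r) (Y x r (y - x))) r := fun r hr =>
      (hβ x hx r (hsub hr)).add (by
        simpa using (hY x hx r (hsub hr)).clm_apply (hasDerivAt_const r (y - x)))
    have hI : Ico 0 t ⊆ Icc 0 t := Ico_subset_Icc_self
    -- Grönwall: `β x + Y x (y - x)` solves the equation up to a defect quadratic in `y - x` and has
    -- the same initial value as `β y`, so the two differ by a quadratic term.
    have := dist_le_of_approx_trajectories_ODE_of_mem (v := fun _ => f) (s := fun _ => s)
      (K := K) (a := 0) (b := t) (f := β y) (g := fun r => β x r + Y x r (y - x))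
      (f' := fun r => f (β y r)) (g' := fun r => f (β x r) + f' (β x r) (Y x r (y - x)))
      (εf := 0) (εg := K₂ * C ^ 2 * ‖y - x‖ ^ 2) (δ := 0)
      (fun _ _ => hK)
      (fun r hr => (hβ y hyU r (hsub hr)).continuousAt.continuousWithinAt)
      (fun r hr => (hβ y hyU r (hsub (hI hr))).hasDerivWithinAt)
      (fun r hr => by simp) (fun r hr => hβs y hyU r (hsub (hI hr)))
      (fun r hr => (hzd r hr).continuousAt.continuousWithinAt)
      (fun r hr => (hzd r (hI hr)).hasDerivWithinAt)
      (fun r hr => by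
        have h2 := hs.norm_sub_sub_fderiv_le hf hK₂ (hβs x hx r (hsub (hI hr))) (hz r (hI hr))
        rw [dist_comm, dist_eq_norm, ← sub_sub]
        simp only [add_sub_cancel_left] at h2
        refine h2.trans ?_
        rw [mul_assoc, ← mul_pow]
        gcongr
        exact hη r (hI hr))
      (fun r hr => hz r (hI hr))
      (by simp [hβ0 x hx, hβ0 y hyU, hY0 x hx]) t ⟨ht0, le_rfl⟩
    rw [dist_eq_norm, ← sub_sub, zero_add, sub_zero] at this
    refine this.trans (le_of_eq ?_)
    by_cases hK0 : (K : ℝ) = 0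
    · simp [gronwallBound, hK0]; ring
    · simp [gronwallBound, hK0]; ring
  rw [hasFDerivAt_iff_isLittleO]
  refine (Asymptotics.IsBigO.of_bound _ (key.mono fun y hy => hy.trans (by
    rw [Real.norm_of_nonneg (by positivity)] : _ ≤ _ * ‖‖y - x‖ ^ 2‖))).trans_isLittleO ?_
  have := (Asymptotics.isLittleO_norm_pow_id (E' := E) one_lt_two).comp_tendsto
    (k := fun y => y - x) (l' := 𝓝 x) (by
      have : Tendsto (fun y : E => y - x) (𝓝 x) (𝓝 (x - x)) := Continuous.tendsto (by fun_prop) x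
      simpa using this)
  exact this

/-- Negative times reduce to positive ones by reversing time, which replaces `f` by `-f`. -/
theorem hasFDerivAt_of_linearised {f : E → E} {s : Set E} (hs : Convex ℝ s)
    (hso : IsOpen s) {f' : E → E →L[ℝ] E} {K K₂ : NNReal}
    (hf : ∀ x ∈ s, HasFDerivAt f (f' x) x) (hK : LipschitzOnWith K f s)
    (hK₂ : LipschitzOnWith K₂ f' s) {U : Set E} (hU : IsOpen U) {τ : ℝ}
    {β : E → ℝ → E} {Y : E → ℝ → E →L[ℝ] E}
    (hβ0 : ∀ x ∈ U, β x 0 = x) (hβs : ∀ x ∈ U, ∀ t ∈ Ioo (-τ) τ, β x t ∈ s)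
    (hβ : ∀ x ∈ U, ∀ t ∈ Ioo (-τ) τ, HasDerivAt (β x) (f (β x t)) t)
    (hY0 : ∀ x ∈ U, Y x 0 = ContinuousLinearMap.id ℝ E)
    (hY : ∀ x ∈ U, ∀ t ∈ Ioo (-τ) τ, HasDerivAt (Y x) ((f' (β x t)).comp (Y x t)) t)
    {x : E} (hx : x ∈ U) {t : ℝ} (ht : t ∈ Ioo (-τ) τ) :
    HasFDerivAt (fun y => β y t) (Y x t) x := by
  rcases le_total 0 t with h0 | h0
  · exact hasFDerivAt_of_linearised_nonneg hs hso hf hK hK₂ hU hβ0 hβs hβ hY0 hY hx h0 ht.2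
  have hn : ∀ r ∈ Ioo (-τ) τ, -r ∈ Ioo (-τ) τ := fun r hr =>
    ⟨by linarith [hr.2], by linarith [hr.1]⟩
  have := hasFDerivAt_of_linearised_nonneg (f := fun x => -f x) (f' := fun x => -f' x)
    (β := fun x t => β x (-t)) (Y := fun x t => Y x (-t)) (τ := τ) (t := -t) hs hso
    (fun x hx => (hf x hx).neg) hK.neg hK₂.neg hU (by simpa using hβ0)
    (fun x hx r hr => hβs x hx _ (hn r hr))
    (fun x hx r hr => by
      simpa [Function.comp_def] using (hβ x hx _ (hn r hr)).scomp r (hasDerivAt_neg r))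
    (by simpa using hY0)
    (fun x hx r hr => by
      have := (hY x hx _ (hn r hr)).scomp r (hasDerivAt_neg r)
      simp only [Function.comp_def, neg_smul, one_smul] at this
      simpa using this)
    hx (by linarith) (by linarith [ht.1])
  simpa using this

/-- The local flow of a `C²` vector field is continuous, and differentiable in the initial value. -/
theorem ContDiffAt.exists_local_flow [CompleteSpace E] {f : E → E} {x₀ : E}
    (hf : ContDiffAt ℝ 2 f x₀) {W : Set E} (hW : W ∈ 𝓝 x₀) :
    ∃ U : Set E, IsOpen U ∧ x₀ ∈ U ∧ ∃ τ > (0 : ℝ), ∃ β : E → ℝ → E,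
      (∀ x ∈ U, β x 0 = x) ∧
      (∀ x ∈ U, ∀ t ∈ Ioo (-τ) τ, β x t ∈ W ∧ HasDerivAt (β x) (f (β x t)) t ∧
        DifferentiableAt ℝ (fun y => β y t) x) ∧
      ContinuousOn (Function.uncurry β) (U ×ˢ Ioo (-τ) τ) := by
  have hf1 : ContDiffAt ℝ 1 f x₀ := hf.of_le (by norm_num)
  have hf' : ContDiffAt ℝ 1 (fderiv ℝ f) x₀ := hf.fderiv_right (by norm_num)
  obtain ⟨K, s₁, hs₁, hK⟩ := hf1.exists_lipschitzOnWith
  obtain ⟨K₂, s₂, hs₂, hK₂⟩ := hf'.exists_lipschitzOnWith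
  have hdiff : ∀ᶠ x in 𝓝 x₀, HasFDerivAt f (fderiv ℝ f x) x :=
    (hf1.eventually (by simp)).mono fun x hx => (hx.differentiableAt (by simp)).hasFDerivAt
  obtain ⟨a, ha, has⟩ := Metric.eventually_nhds_iff_ball.1
    (hdiff.and (Filter.eventually_of_mem (inter_mem (inter_mem hs₁ hs₂) hW) fun x hx => hx))
  -- The field coupled with its linearisation. It is `C¹` because `f` is `C²`, so a single
  -- application of Picard–Lindelöf gives both the trajectories and their candidate derivatives.
  let F : E × (E →L[ℝ] E) → E × (E →L[ℝ] E) := fun p => (f p.1, (fderiv ℝ f p.1).comp p.2)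
  have hF : ContDiffAt ℝ 1 F (x₀, ContinuousLinearMap.id ℝ E) := by
    refine ContDiffAt.prodMk ?_ (ContDiffAt.clm_comp ?_ contDiffAt_snd)
    · exact ContDiffAt.comp (x₀, ContinuousLinearMap.id ℝ E) hf1 contDiffAt_fst
    · exact ContDiffAt.comp (x₀, ContinuousLinearMap.id ℝ E) hf' contDiffAt_fst
  obtain ⟨ε, hε, b, r, L, K', hr, hpl⟩ := IsPicardLindelof.of_contDiffAt_one hF
  obtain ⟨α, hα, hαc⟩ := (hpl 0).exists_forall_mem_closedBall_eq_hasDerivWithinAt_continuousOn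
  set p₀ : E × (E →L[ℝ] E) := (x₀, ContinuousLinearMap.id ℝ E) with hp₀
  have hmem : Metric.closedBall p₀ r ×ˢ Icc (0 - ε) (0 + ε) ∈ 𝓝 (p₀, (0 : ℝ)) :=
    prod_mem_nhds (Metric.closedBall_mem_nhds _ hr) (Icc_mem_nhds (by linarith) (by linarith))
  have hαat : ContinuousAt α (p₀, 0) := hαc.continuousAt hmem
  have hα0 : α (p₀, 0) = p₀ := (hα p₀ (Metric.mem_closedBall_self r.2)).1
  have hball : ∀ᶠ q in 𝓝 (x₀, (0 : ℝ)),
      (α ((q.1, ContinuousLinearMap.id ℝ E), q.2)).1 ∈ Metric.ball x₀ a := by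
    have h1 : ContinuousAt (fun q : E × ℝ => (α ((q.1, ContinuousLinearMap.id ℝ E), q.2)).1)
        (x₀, 0) := by
      refine continuousAt_fst.comp (ContinuousAt.comp (g := α) (f := fun q : E × ℝ =>
        ((q.1, ContinuousLinearMap.id ℝ E), q.2)) hαat ?_)
      exact Continuous.continuousAt (by fun_prop)
    refine h1.eventually (Metric.isOpen_ball.mem_nhds ?_)
    simp only [← hp₀, hα0]
    exact Metric.mem_ball_self ha
  have hα00 : ∀ p ∈ Metric.closedBall p₀ (r : ℝ), α (p, 0) = p := fun p hp => (hα p hp).1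
  obtain ⟨u, hu, w, hw, huw⟩ := mem_nhds_prod_iff.1 hball
  obtain ⟨r', hr', hr'u⟩ := Metric.mem_nhds_iff.1 hu
  obtain ⟨τ', hτ', hτ'w⟩ := Metric.mem_nhds_iff.1 hw
  rw [Real.ball_eq_Ioo, zero_sub, zero_add] at hτ'w
  have hsubτ : Ioo (-min τ' ε) (min τ' ε) ⊆ Ioo (-τ') τ' := Ioo_subset_Ioo
    (neg_le_neg (min_le_left _ _)) (min_le_left _ _)
  have hsubε : Ioo (-min τ' ε) (min τ' ε) ⊆ Ioo (0 - ε) (0 + ε) := Ioo_subset_Ioo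
    (by rw [zero_sub]; exact neg_le_neg (min_le_right _ _))
    (by rw [zero_add]; exact min_le_right _ _)
  have hUr : ∀ x ∈ Metric.ball x₀ (min r' r), (x, ContinuousLinearMap.id ℝ E) ∈
      Metric.closedBall p₀ r := fun x hx => by
    rw [Metric.mem_closedBall, hp₀, Prod.dist_eq]
    simp only [dist_self]
    exact max_le ((Metric.mem_ball.1 hx).le.trans (min_le_right _ _)) r.2
  have hD : ∀ x ∈ Metric.ball x₀ (min r' r), ∀ t ∈ Ioo (-min τ' ε) (min τ' ε),
      HasDerivAt (fun t => α ((x, ContinuousLinearMap.id ℝ E), t))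
        (F (α ((x, ContinuousLinearMap.id ℝ E), t))) t := fun x hx t ht =>
    ((hα _ (hUr x hx)).2 t (Ioo_subset_Icc_self (hsubε ht))).hasDerivAt
      (Icc_mem_nhds (hsubε ht).1 (hsubε ht).2)
  have hin : ∀ x ∈ Metric.ball x₀ (min r' r), ∀ t ∈ Ioo (-min τ' ε) (min τ' ε),
      (α ((x, ContinuousLinearMap.id ℝ E), t)).1 ∈ Metric.ball x₀ a := fun x hx t ht =>
    huw (mk_mem_prod (hr'u (Metric.ball_subset_ball (min_le_left _ _) hx))
      (hτ'w (hsubτ ht)))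
  refine ⟨Metric.ball x₀ (min r' r), Metric.isOpen_ball, Metric.mem_ball_self (lt_min hr' hr),
    min τ' ε, lt_min hτ' hε, fun x t => (α ((x, ContinuousLinearMap.id ℝ E), t)).1,
    fun x hx => by simp only [hα00 _ (hUr x hx)],
    fun x hx t ht => ⟨(has _ (hin x hx t ht)).2.2, ?_, ?_⟩,
    ?_⟩
  · exact (hD x hx t ht).fst
  · refine (hasFDerivAt_of_linearised (s := Metric.ball x₀ a) (f' := fderiv ℝ f)
      (β := fun x t => (α ((x, ContinuousLinearMap.id ℝ E), t)).1)
      (Y := fun x t => (α ((x, ContinuousLinearMap.id ℝ E), t)).2) (convex_ball x₀ a)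
      Metric.isOpen_ball (fun x hx => (has x hx).1) (hK.mono fun x hx => (has x hx).2.1.1)
      (hK₂.mono fun x hx => (has x hx).2.1.2) Metric.isOpen_ball
      (fun x hx => by simp only [hα00 _ (hUr x hx)]) hin (fun x hx t ht => (hD x hx t ht).fst)
      (fun x hx => by simp only [hα00 _ (hUr x hx)]) (fun x hx t ht => (hD x hx t ht).snd)
      hx ht).differentiableAt
  · refine continuous_fst.comp_continuousOn (hαc.comp (f := fun q : E × ℝ =>
      ((q.1, ContinuousLinearMap.id ℝ E), q.2)) (by fun_prop) ?_)
    intro q hq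
    exact ⟨hUr _ hq.1, Ioo_subset_Icc_self (hsubε hq.2)⟩

end LocalFlow

/-! ### Flows of complete vector fields on manifolds -/

section ManifoldFlow

variable {E : Type*} [NormedAddCommGroup E] [NormedSpace ℝ E]
  {H : Type*} [TopologicalSpace H] {I : ModelWithCorners ℝ E H}
  {M : Type*} [TopologicalSpace M] [ChartedSpace H M] [IsManifold I 1 M]
  [I.Boundaryless]
  {X : (x : M) → TangentSpace I x}

/-- A curve that solves the equation of a vector field in a chart is an integral curve. -/
theorem hasMFDerivAt_extChartAt_symm_comp {x₀ : M} {f : ℝ → E} {t : ℝ}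
    (hf : f t ∈ (extChartAt I x₀).target)
    (h : HasDerivAt f (tangentCoordChange I ((extChartAt I x₀).symm (f t)) x₀
      ((extChartAt I x₀).symm (f t)) (X ((extChartAt I x₀).symm (f t)))) t) :
    HasMFDerivAt 𝓘(ℝ, ℝ) I ((extChartAt I x₀).symm ∘ f) t
      ((1 : ℝ →L[ℝ] ℝ).smulRight (X (((extChartAt I x₀).symm ∘ f) t))) := by
  let xₜ : M := (extChartAt I x₀).symm (f t)
  have hft1 : xₜ ∈ (extChartAt I x₀).source := (extChartAt I x₀).map_target hf
  have hft2 := mem_extChartAt_source (I := I) xₜ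
  have key : ∀ w : E, HasDerivAt f (tangentCoordChange I xₜ x₀ xₜ w) t →
      HasDerivAt ((extChartAt I xₜ ∘ (extChartAt I x₀).symm) ∘ f) w t := fun w h => by
    rw [← tangentCoordChange_self (I := I) (x := xₜ) (z := xₜ) (v := w) hft2,
      ← tangentCoordChange_comp (x := x₀) ⟨⟨hft2, hft1⟩, hft2⟩]
    apply HasFDerivAt.comp_hasDerivAt _ _ h
    apply HasFDerivWithinAt.hasFDerivAt (s := range I) _ <|
      mem_nhds_iff.mpr ⟨(extChartAt I x₀).target, extChartAt_target_subset_range ..,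
        isOpen_extChartAt_target x₀, hf⟩
    rw [← (extChartAt I x₀).right_inv hf]
    exact hasFDerivWithinAt_tangentCoordChange ⟨hft1, hft2⟩
  refine ⟨(continuousAt_extChartAt_symm'' hf).comp h.continuousAt, ?_⟩
  simp only [mfld_simps]
  exact (key _ h).hasFDerivAt.hasFDerivWithinAt

/-- The local flow of a `C²` vector field on a manifold is continuous, and differentiable in the
initial value. -/
theorem exists_local_flow_of_contMDiff [CompleteSpace E] [IsManifold I 2 M]
    (hX : ContMDiff I I.tangent 2 fun x => (⟨x, X x⟩ : TangentBundle I M)) (x₀ : M) :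
    ∃ N : Set M, IsOpen N ∧ x₀ ∈ N ∧ ∃ τ > (0 : ℝ), ∃ φ : ℝ → M → M,
      (∀ x ∈ N, φ 0 x = x ∧ IsMIntegralCurveOn (fun t => φ t x) X (Ioo (-τ) τ)) ∧
      (∀ x ∈ N, ∀ t ∈ Ioo (-τ) τ, MDifferentiableAt I I (φ t) x) ∧
      ContinuousOn (Function.uncurry φ) (Ioo (-τ) τ ×ˢ N) := by
  obtain ⟨_, hv⟩ := contMDiffAt_iff.1 (hX.contMDiffAt (x := x₀))
  have hv2 := (hv.contDiffAt (range_mem_nhds_isInteriorPoint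
    (BoundarylessManifold.isInteriorPoint (I := I) (x := x₀)))).snd
  set e := extChartAt I x₀ with he
  obtain ⟨U, hU, hx₀U, τ, hτ, β, hβ0, hβ, hβc⟩ :=
    hv2.exists_local_flow (extChartAt_target_mem_nhds (I := I) x₀)
  have hNo : IsOpen (e.source ∩ e ⁻¹' U) :=
    (continuousOn_extChartAt x₀).isOpen_inter_preimage (isOpen_extChartAt_source x₀) hU
  refine ⟨e.source ∩ e ⁻¹' U, hNo, ⟨mem_extChartAt_source x₀, hx₀U⟩, τ, hτ,
    fun t x => e.symm (β (e x) t), fun x hx => ⟨?_, fun t ht => ?_⟩, fun x hx t ht => ?_, ?_⟩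
  · simp only
    rw [hβ0 _ hx.2, e.left_inv hx.1]
  · exact (hasMFDerivAt_extChartAt_symm_comp (hβ _ hx.2 t ht).1
      (hβ _ hx.2 t ht).2.1).hasMFDerivWithinAt
  · obtain ⟨h1, -, h3⟩ := hβ _ hx.2 t ht
    have h4 : MDifferentiableAt I 𝓘(ℝ, E) e x :=
      (contMDiffAt_extChartAt' (n := 1)
        (by rw [← extChartAt_source I]; exact hx.1)).mdifferentiableAt (by simp)
    have h5 : MDifferentiableAt 𝓘(ℝ, E) I e.symm (β (e x) t) :=
      ((contMDiffOn_extChartAt_symm (n := 1) x₀).contMDiffAt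
        ((isOpen_extChartAt_target x₀).mem_nhds h1)).mdifferentiableAt (by simp)
    exact h5.comp x (MDifferentiableAt.comp (g := fun y => β y t) x
      h3.mdifferentiableAt h4)
  · refine (continuousOn_extChartAt_symm x₀).comp (f := fun q : ℝ × M => β (e q.2) q.1) ?_ ?_
    · refine hβc.comp (f := fun q : ℝ × M => (e q.2, q.1)) (ContinuousOn.prodMk ?_ (by fun_prop))
        fun q hq => ⟨hq.2.2, hq.1⟩
      exact (continuousOn_extChartAt x₀).comp (by fun_prop) fun q hq => hq.2.1
    · exact fun q hq => (hβ _ hq.2.2 _ hq.1).1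

variable [T2Space M]

/-- The global integral curves of a complete `C²` vector field form a flow of differentiable
maps. -/
theorem exists_flow_of_complete [CompleteSpace E] [IsManifold I 2 M]
    (hX : ContMDiff I I.tangent 2 fun x => (⟨x, X x⟩ : TangentBundle I M))
    {φ : ℝ → M → M} (hφ : ∀ x, φ 0 x = x ∧ IsMIntegralCurve (fun t => φ t x) X) :
    ∃ ψ : Flow ℝ M, (∀ t x, ψ t x = φ t x) ∧ ∀ t, MDifferentiable I I (ψ t) := by
  have hX1 := hX.of_le (m := 1) (by norm_num)
  have hadd : ∀ s t x, φ (s + t) x = φ s (φ t x) := fun s t x => by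
    have h1 : IsMIntegralCurve (fun s => φ (s + t) x) X := (hφ x).2.comp_add t
    have := isMIntegralCurve_Ioo_eq_of_contMDiff_boundaryless (t₀ := 0) hX1 h1 (hφ (φ t x)).2
      (by simp [(hφ (φ t x)).1])
    exact congrFun this s
  have hloc : ∀ x₀ : M, ∃ N : Set M, IsOpen N ∧ x₀ ∈ N ∧ ∃ τ > (0 : ℝ),
      (∀ x ∈ N, ∀ t ∈ Ioo (-τ) τ, MDifferentiableAt I I (φ t) x) ∧
      ContinuousOn (Function.uncurry φ) (Ioo (-τ) τ ×ˢ N) := fun x₀ => by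
    obtain ⟨N, hN, hx₀, τ, hτ, ψ, h1, h2, h3⟩ := exists_local_flow_of_contMDiff hX x₀
    have heq : ∀ x ∈ N, ∀ t ∈ Ioo (-τ) τ, φ t x = ψ t x := fun x hx t ht =>
      isMIntegralCurveOn_Ioo_eqOn_of_contMDiff_boundaryless (t₀ := 0)
        ⟨by linarith, hτ⟩ hX1 ((hφ x).2.isMIntegralCurveOn _) (h1 x hx).2
        (by simp only [(hφ x).1, (h1 x hx).1]) ht
    refine ⟨N, hN, hx₀, τ, hτ, fun x hx t ht => ?_, ?_⟩
    · exact (h2 x hx t ht).congr_of_eventuallyEq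
        (eventually_of_mem (hN.mem_nhds hx) fun y hy => heq y hy t ht)
    · exact h3.congr fun q hq => heq _ hq.2 _ hq.1
  have hdiff : ∀ t, MDifferentiable I I (φ t) := fun t x => by
    have hcurve : Continuous fun t => φ t x := (hφ x).2.continuous
    -- Short-time maps are differentiable near `φ t x`, and `φ s' = φ (s' - s) ∘ φ s`. So
    -- differentiability at `x` neither appears nor disappears as the time varies, and it holds at
    -- time `0`.
    have hlc : IsLocallyConstant fun t => MDifferentiableAt I I (φ t) x := by
      rw [IsLocallyConstant.iff_eventually_eq]
      intro t
      obtain ⟨N, hN, hx₀, τ, hτ, h1, -⟩ := hloc (φ t x)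
      have hstep : ∀ s s', φ s x ∈ N → |s' - s| < τ → MDifferentiableAt I I (φ s) x →
          MDifferentiableAt I I (φ s') x := fun s s' hs hss h => by
        have : φ s' = φ (s' - s) ∘ φ s := funext fun y => by
          simp [← hadd]
        rw [this]
        exact (h1 _ hs _ (abs_lt.1 hss)).comp x h
      filter_upwards [hcurve.continuousAt.eventually (hN.mem_nhds hx₀),
        Metric.ball_mem_nhds t hτ] with s hs hst
      rw [Metric.mem_ball, Real.dist_eq] at hst
      exact propext ⟨hstep s t hs (by rwa [abs_sub_comm]), hstep t s hx₀ hst⟩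
    have := hlc.apply_eq_of_isPreconnected isPreconnected_univ (mem_univ t) (mem_univ 0)
    rw [this]
    have h0 : φ 0 = id := funext fun y => (hφ y).1
    rw [h0]
    exact mdifferentiableAt_id
  have hcont : Continuous (Function.uncurry φ) := by
    rw [continuous_iff_continuousAt]
    rintro ⟨t, x⟩
    obtain ⟨N, hN, hx₀, τ, hτ, -, h2⟩ := hloc (φ t x)
    have hat : ContinuousAt (Function.uncurry φ) (0, φ t x) := h2.continuousAt
      (prod_mem_nhds (Ioo_mem_nhds (by linarith) hτ) (hN.mem_nhds hx₀))
    -- Continuity at `(t, x)` is moved to time `0` at the point `φ t x` by splitting off the fixed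
    -- time `t`.
    have heq : Function.uncurry φ = Function.uncurry φ ∘ fun q : ℝ × M => (q.1 - t, φ t q.2) :=
      funext fun q => by simp [Function.uncurry, ← hadd]
    rw [heq]
    refine ContinuousAt.comp ?_ ?_
    · simpa using hat
    · refine ContinuousAt.prodMk (by fun_prop) ?_
      exact ContinuousAt.comp (g := φ t) (f := Prod.snd) (x := (t, x))
        (hdiff t x).continuousAt continuousAt_snd
  exact ⟨⟨φ, hcont, hadd, fun x => (hφ x).1⟩, fun _ _ => rfl, hdiff⟩

end ManifoldFlow

/-! ### Flows with a proper strict Lyapunov function -/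

section Dynamics

variable {M : Type*} [TopologicalSpace M]

/-- `h` is a proper strict Lyapunov function of the flow `φ` with set of rest points `C`, finite
between any two levels. -/
structure IsLyapunov (φ : Flow ℝ M) (h : M → ℝ) (C : Set M) : Prop where
  cont : Continuous h
  compact : ∀ a b, IsCompact (h ⁻¹' Icc a b)
  strictAnti : ∀ x ∉ C, StrictAnti fun t => h (φ t x)
  fixed : ∀ x ∈ C, ∀ t, φ t x = x
  finite : ∀ a b, (C ∩ h ⁻¹' Icc a b).Finite

/-- `y` lies on the orbit of `x` or is one of its limits at `±∞`. -/
def FlowConn (φ : Flow ℝ M) (x y : M) : Prop :=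
  (∃ t, φ t x = y) ∨ Tendsto (fun t => φ t x) atTop (𝓝 y) ∨ Tendsto (fun t => φ t x) atBot (𝓝 y)

/-- `x` is not on a critical level, and no critical level lies strictly between `x` and the
level `s`. -/
def LevelAdj (h : M → ℝ) (C : Set M) (x : M) (s : ℝ) : Prop :=
  ∀ c ∈ C, h x ≠ h c ∧ (h x < h c → s ≤ h c) ∧ (h c < h x → h c ≤ s)

theorem FlowConn.reverse {φ : Flow ℝ M} {x y : M} (H : FlowConn φ x y) :
    FlowConn φ.reverse x y := by
  rcases H with ⟨t, ht⟩ | H | H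
  · exact .inl ⟨-t, by simpa using ht⟩
  · exact .inr (.inr (H.comp tendsto_neg_atBot_atTop))
  · exact .inr (.inl (H.comp tendsto_neg_atTop_atBot))

omit [TopologicalSpace M] in
theorem LevelAdj.neg {h : M → ℝ} {C : Set M} {x : M} {s : ℝ} (H : LevelAdj h C x s) :
    LevelAdj (fun x => -h x) C x (-s) := fun c hc => by
  obtain ⟨h1, h2, h3⟩ := H c hc
  refine ⟨fun h => h1 (neg_injective h), fun h => ?_, fun h => ?_⟩
  · exact neg_le_neg (h3 (neg_lt_neg_iff.1 h))
  · exact neg_le_neg (h2 (neg_lt_neg_iff.1 h))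

omit [TopologicalSpace M] in
theorem LevelAdj.notMem {h : M → ℝ} {C : Set M} {x : M} {s : ℝ} (H : LevelAdj h C x s) :
    x ∉ C := fun hx => (H x hx).1 rfl

theorem FlowConn.refl (φ : Flow ℝ M) (x : M) : FlowConn φ x x := .inl ⟨0, φ.map_zero_apply x⟩

/-- A finite set can be avoided by the frontiers of small neighbourhoods of a point. -/
theorem Set.Finite.exists_isOpen_frontier_disjoint [T2Space M] {F : Set M} (hF : F.Finite) {u : M}
    {W : Set M} (hW : W ∈ 𝓝 u) :
    ∃ U ⊆ W, IsOpen U ∧ u ∈ U ∧ Disjoint (frontier U) F := by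
  obtain ⟨U₀, V, hU₀, hV, huU₀, hFV, hd⟩ := SeparatedNhds.of_isCompact_isCompact
    (isCompact_singleton (x := u)) (hF.subset (sdiff_subset (t := {u}))).isCompact
    (disjoint_singleton_left.2 fun h => h.2 rfl)
  obtain ⟨W', hW'W, hW', huW'⟩ := mem_nhds_iff.1 hW
  refine ⟨U₀ ∩ W', inter_subset_right.trans hW'W, hU₀.inter hW',
    ⟨huU₀ rfl, huW'⟩, disjoint_left.2 fun z hz hzF => ?_⟩
  rw [(hU₀.inter hW').frontier_eq] at hz
  by_cases hzu : z = u
  · exact hz.2 (hzu ▸ ⟨huU₀ rfl, huW'⟩)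
  · exact (hd.closure_left hV).le_bot ⟨closure_mono inter_subset_left hz.1, hFV ⟨hzF, hzu⟩⟩

theorem Flow.exists_mem_frontier (φ : Flow ℝ M) {x : M} {U : Set M} {s t : ℝ} (hs : φ s x ∈ U)
    (ht : φ t x ∉ U) : ∃ r ∈ uIcc s t, φ r x ∈ frontier U := by
  have hp : IsPreconnected ((fun r => φ r x) '' uIcc s t) :=
    isPreconnected_uIcc.image _ (φ.continuous continuous_id continuous_const).continuousOn
  by_contra! hno
  have hcov : (fun r => φ r x) '' uIcc s t ⊆ interior U ∪ (closure U)ᶜ := by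
    rintro _ ⟨r, hr, rfl⟩
    by_contra hr'
    rw [mem_union, not_or, notMem_compl_iff] at hr'
    exact hno r hr ⟨hr'.2, hr'.1⟩
  obtain ⟨z, -, hz1, hz2⟩ := hp _ _ isOpen_interior isClosed_closure.isOpen_compl hcov
    ⟨_, mem_image_of_mem _ left_mem_uIcc, ((hcov (mem_image_of_mem _ left_mem_uIcc)).resolve_right
      fun hn => hn (subset_closure hs))⟩
    ⟨_, mem_image_of_mem _ right_mem_uIcc, ((hcov (mem_image_of_mem _ right_mem_uIcc)).resolve_left
      fun hn => ht (interior_subset hn))⟩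
  exact hz2 (interior_subset_closure hz1)

namespace IsLyapunov

variable {φ : Flow ℝ M} {h : M → ℝ} {C : Set M} (L : IsLyapunov φ h C)
include L

/-- Time reversal together with the sign change of `h` exchanges the two ends of an orbit, so only
the behaviour at `+∞` needs a direct proof. -/
theorem reverse : IsLyapunov φ.reverse (fun x => -h x) C where
  cont := L.cont.neg
  compact a b := by
    convert L.compact (-b) (-a) using 1
    ext x
    simp only [mem_preimage, mem_Icc]
    constructor <;> rintro ⟨h1, h2⟩ <;> constructor <;> linarith
  strictAnti x hx s t hst := by
    simpa using L.strictAnti x hx (neg_lt_neg hst)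
  fixed x hx t := by simpa using L.fixed x hx (-t)
  finite a b := by
    convert L.finite (-b) (-a) using 2
    ext x
    simp only [mem_preimage, mem_Icc]
    constructor <;> rintro ⟨h1, h2⟩ <;> constructor <;> linarith

theorem antitone (x : M) : Antitone fun t => h (φ t x) := by
  by_cases hx : x ∈ C
  · intro s t _
    simp [L.fixed x hx]
  · exact (L.strictAnti x hx).antitone

theorem map_notMem {x : M} (hx : x ∉ C) (t : ℝ) : φ t x ∉ C := fun ht => by
  have h1 := L.fixed _ ht 1
  rw [← φ.map_add] at h1
  have := L.strictAnti x hx (show t < 1 + t by linarith)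
  simp [h1] at this

variable [T2Space M]

/-- A limit of a trajectory is fixed by the time-one map, which would lower `h` strictly off `C`. -/
theorem mem_of_tendsto_atTop {x y : M} (hy : Tendsto (fun t => φ t x) atTop (𝓝 y)) : y ∈ C := by
  by_contra hC
  have h1 : Tendsto (fun t => φ (1 + t) x) atTop (𝓝 y) :=
    hy.comp (tendsto_atTop_add_const_left _ _ tendsto_id)
  have h2 : Tendsto (fun t => φ (1 + t) x) atTop (𝓝 (φ 1 y)) := by
    simp_rw [φ.map_add]
    exact ((φ.continuous_toFun 1).tendsto y).comp hy
  have h3 := L.strictAnti y hC zero_lt_one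
  simp [tendsto_nhds_unique h2 h1, φ.map_zero_apply] at h3

theorem mem_of_tendsto_atBot {x y : M} (hy : Tendsto (fun t => φ t x) atBot (𝓝 y)) : y ∈ C :=
  L.reverse.mem_of_tendsto_atTop (hy.comp tendsto_neg_atTop_atBot)

omit [T2Space M] in
theorem lt_of_tendsto_atTop {x y : M} (hx : x ∉ C) (hy : Tendsto (fun t => φ t x) atTop (𝓝 y))
    (t : ℝ) : h y < h (φ t x) :=
  ((L.antitone x).le_of_tendsto ((L.cont.tendsto y).comp hy) (t + 1)).trans_lt
    (L.strictAnti x hx (by linarith))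

omit [T2Space M] in
theorem lt_of_tendsto_atBot {x y : M} (hx : x ∉ C) (hy : Tendsto (fun t => φ t x) atBot (𝓝 y))
    (t : ℝ) : h (φ t x) < h y := by
  have := L.reverse.lt_of_tendsto_atTop hx (hy.comp tendsto_neg_atTop_atBot) (-t)
  simpa using this

/-- `h` is injective on an orbit with its ends added: it decreases strictly along the orbit, and the
ends lie strictly below and above it. -/
theorem conn_unique {x y y' : M} (hx : x ∉ C) (hy : FlowConn φ x y) (hy' : FlowConn φ x y')
    (heq : h y = h y') : y = y' := by
  rcases hy with ⟨t, rfl⟩ | hy | hy <;> rcases hy' with ⟨t', rfl⟩ | hy' | hy'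
  · rw [(L.strictAnti x hx).injective heq]
  · exact absurd heq (L.lt_of_tendsto_atTop hx hy' t).ne'
  · exact absurd heq (L.lt_of_tendsto_atBot hx hy' t).ne
  · exact absurd heq (L.lt_of_tendsto_atTop hx hy t').ne
  · exact tendsto_nhds_unique hy hy'
  · exact absurd heq ((L.lt_of_tendsto_atTop hx hy 0).trans (L.lt_of_tendsto_atBot hx hy' 0)).ne
  · exact absurd heq (L.lt_of_tendsto_atBot hx hy t').ne'
  · exact absurd heq ((L.lt_of_tendsto_atTop hx hy' 0).trans (L.lt_of_tendsto_atBot hx hy 0)).ne'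
  · exact tendsto_nhds_unique hy hy'

theorem orbit_of_conn {x y : M} (hy : FlowConn φ x y) (hyC : y ∉ C) : ∃ t, φ t x = y := by
  rcases hy with hy | hy | hy
  · exact hy
  · exact absurd (L.mem_of_tendsto_atTop hy) hyC
  · exact absurd (L.mem_of_tendsto_atBot hy) hyC

/-- A trajectory on which `h` is bounded below converges to a rest point. -/
theorem exists_tendsto_atTop {x : M} {a : ℝ} (ha : ∀ t ≥ 0, a ≤ h (φ t x)) :
    ∃ u ∈ C, Tendsto (fun t => φ t x) atTop (𝓝 u) := by
  by_cases hx : x ∈ C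
  · exact ⟨x, hx, by simp [L.fixed x hx]⟩
  set K := h ⁻¹' Icc a (h x) with hK
  have hmem : ∀ t ≥ 0, φ t x ∈ K := fun t ht => ⟨ha t ht, by
    simpa [φ.map_zero_apply] using L.antitone x ht⟩
  have hev : ∀ᶠ t in atTop, φ t x ∈ K := (eventually_ge_atTop 0).mono hmem
  obtain ⟨l, hl⟩ : ∃ l, Tendsto (fun t => h (φ t x)) atTop (𝓝 l) := by
    rcases tendsto_atTop_of_antitone (L.antitone x) with h1 | h1
    · obtain ⟨t, h2, h3⟩ := ((h1.eventually (eventually_lt_atBot a)).and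
        (eventually_ge_atTop 0)).exists
      exact absurd (ha t h3) (not_le.2 h2)
    · exact h1
  -- LaSalle's argument: at a cluster point `z`, both `h z` and `h (φ 1 z)` equal the limit of `h`
  -- along the trajectory.
  have hclus : ∀ z, MapClusterPt z atTop (fun t => φ t x) → z ∈ C := fun z hz => by
    by_contra hzC
    obtain ⟨𝒰, h𝒰, hz⟩ := mapClusterPt_iff_ultrafilter.1 hz
    have h1 : h z = l := tendsto_nhds_unique ((L.cont.tendsto z).comp hz) (hl.mono_left h𝒰)
    have h2 : Tendsto (fun t => h (φ (1 + t) x)) 𝒰 (𝓝 (h (φ 1 z))) := by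
      simp_rw [φ.map_add]
      exact ((L.cont.comp (φ.continuous_toFun 1)).tendsto z).comp hz
    have h3 : Tendsto (fun t => h (φ (1 + t) x)) 𝒰 (𝓝 l) :=
      (hl.comp (tendsto_atTop_add_const_left _ (1 : ℝ) tendsto_id)).mono_left h𝒰
    have h4 := L.strictAnti z hzC zero_lt_one
    simp [tendsto_nhds_unique h2 h3, φ.map_zero_apply, h1] at h4
  obtain ⟨u, huK, hu⟩ := (L.compact a (h x)).exists_mapClusterPt_of_frequently hev.frequently
  refine ⟨u, hclus u hu, ?_⟩
  rw [tendsto_iff_forall_eventually_mem]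
  intro W hW
  obtain ⟨U, hUW, hU, huU, hd⟩ := (L.finite a (h x)).exists_isOpen_frontier_disjoint hW
  by_contra hnot
  -- Without convergence the trajectory crosses the frontier of `U` at arbitrarily late times. It
  -- then clusters at a rest point on the frontier, but the frontier was chosen to avoid those.
  have hfr : ∃ᶠ t in atTop, φ t x ∈ frontier U ∩ K := by
    rw [frequently_atTop]
    intro T
    have h1 : ∃ᶠ t in atTop, φ t x ∈ U := hu.frequently (hU.mem_nhds huU)
    have h2 : ∃ᶠ t in atTop, φ t x ∉ U := (not_eventually.1 hnot).mono fun t ht hU => ht (hUW hU)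
    obtain ⟨s, hs, hsU⟩ := frequently_atTop.1 h1 (max T 0)
    obtain ⟨t, ht, htU⟩ := frequently_atTop.1 h2 (max T 0)
    obtain ⟨r, hr, hrU⟩ := φ.exists_mem_frontier hsU htU
    have hr' : max T 0 ≤ r := (le_min hs ht).trans hr.1
    exact ⟨r, (le_max_left _ _).trans hr', hrU, hmem r ((le_max_right _ _).trans hr')⟩
  obtain ⟨z, hz, hzc⟩ := ((L.compact a (h x)).inter_left
    (isClosed_frontier (s := U))).exists_mapClusterPt_of_frequently hfr
  exact hd.le_bot ⟨hz.1, hclus z hzc, hz.2⟩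

/-- Either the orbit crosses the level `s`, or it stays above and converges to a rest point. The
latter must lie on level `s` exactly, since no critical level separates `x` from `s`. -/
theorem exists_conn_of_le {x : M} {s : ℝ} (H : LevelAdj h C x s) (hs : s ≤ h x) :
    ∃ y, FlowConn φ x y ∧ h y = s := by
  by_cases hex : ∃ t ≥ 0, h (φ t x) ≤ s
  · obtain ⟨t, ht, hts⟩ := hex
    have hc : ContinuousOn (fun t => h (φ t x)) (Icc 0 t) :=
      (L.cont.comp (φ.continuous continuous_id continuous_const)).continuousOn
    obtain ⟨r, -, hr⟩ := intermediate_value_Icc' ht hc ⟨hts, by simpa [φ.map_zero_apply] using hs⟩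
    exact ⟨_, .inl ⟨r, rfl⟩, hr⟩
  · push Not at hex
    obtain ⟨u, huC, hu⟩ := L.exists_tendsto_atTop fun t ht => (hex t ht).le
    have h1 : h u < h x := by simpa [φ.map_zero_apply] using L.lt_of_tendsto_atTop H.notMem hu 0
    have h2 : s ≤ h u := ge_of_tendsto ((L.cont.tendsto u).comp hu)
      ((eventually_ge_atTop 0).mono fun t ht => (hex t ht).le)
    exact ⟨u, .inr (.inl hu), le_antisymm ((H u huC).2.2 h1) h2⟩

theorem exists_conn {x : M} {s : ℝ} (H : LevelAdj h C x s) : ∃ y, FlowConn φ x y ∧ h y = s := by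
  rcases le_total s (h x) with hs | hs
  · exact L.exists_conn_of_le H hs
  · obtain ⟨y, hy, hys⟩ := L.reverse.exists_conn_of_le H.neg (neg_le_neg hs)
    refine ⟨y, ?_, neg_injective hys⟩
    have := hy.reverse
    have hr : φ.reverse.reverse = φ := Flow.ext fun t x => by simp
    rwa [hr] at this

omit [T2Space M] in
/-- Trajectories starting near a trajectory that converges to `u` stay near `u` for a long time,
as long as they are above the level of `u`. -/
theorem eventually_mem_of_tendsto_atTop {x₀ u : M} (hx₀ : x₀ ∉ C)
    (hu : Tendsto (fun t => φ t x₀) atTop (𝓝 u)) {U : Set M} (hU : IsOpen U) (huU : u ∈ U)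
    (hd : Disjoint (frontier U) (C ∩ h ⁻¹' Icc (h u) (h x₀))) :
    ∃ T, ∀ᶠ x in 𝓝 x₀, ∀ t ≥ T, h u ≤ h (φ t x) → φ t x ∈ U := by
  -- The relevant frontier points are not rest points and form a compact set, so one unit of time
  -- before reaching any of them `h` is at least some `κ` strictly above `h u`.
  obtain ⟨κ, hκ, hκK⟩ : ∃ κ > h u, ∀ z ∈ frontier U ∩ h ⁻¹' Icc (h u) (h x₀),
      κ ≤ h (φ (-1) z) := by
    rcases (frontier U ∩ h ⁻¹' Icc (h u) (h x₀)).eq_empty_or_nonempty with he | hne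
    · exact ⟨h u + 1, by simp, by simp [he]⟩
    · obtain ⟨z, hz, hmin⟩ := ((L.compact (h u) (h x₀)).inter_left
        (isClosed_frontier (s := U))).exists_isMinOn hne
        (L.cont.comp (φ.continuous_toFun (-1))).continuousOn
      refine ⟨h (φ (-1) z), ?_, fun y hy => hmin hy⟩
      have hzC : z ∉ C := fun hzC => hd.le_bot ⟨hz.1, hzC, hz.2⟩
      have := L.strictAnti z hzC (show (-1 : ℝ) < 0 by norm_num)
      simp only [φ.map_zero_apply] at this
      exact hz.2.1.trans_lt this
  obtain ⟨T₀, hT₀⟩ := eventually_atTop.1 ((hu.eventually (hU.mem_nhds huU)).and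
    (((L.cont.tendsto u).comp hu).eventually (gt_mem_nhds hκ)))
  set T := max T₀ 1 with hT
  have h1 : ∀ t ≥ T, φ t x₀ ∈ U := fun t ht => (hT₀ t ((le_max_left _ _).trans ht)).1
  have h2 : h (φ T x₀) < κ := (hT₀ T (le_max_left _ _)).2
  have h3 : h (φ T x₀) < h x₀ := by
    have := L.strictAnti x₀ hx₀ (show 0 < T from zero_lt_one.trans_le (le_max_right _ _))
    simpa [φ.map_zero_apply] using this
  have hcT : ContinuousAt (fun x => h (φ T x)) x₀ :=
    (L.cont.comp (φ.continuous_toFun T)).continuousAt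
  -- One full unit of time inside `U`, to match the unit of time in the choice of `κ`.
  have htube : ∀ᶠ x in 𝓝 x₀, ∀ t ∈ Icc T (T + 1), φ t x ∈ U := by
    refine isCompact_Icc.eventually_forall_of_forall_eventually fun t ht => ?_
    have : Continuous fun q : M × ℝ => φ q.2 q.1 := φ.continuous continuous_snd continuous_fst
    exact this.continuousAt.eventually (hU.mem_nhds (h1 t ht.1))
  refine ⟨T, ?_⟩
  filter_upwards [htube, hcT.eventually (gt_mem_nhds h2), hcT.eventually (gt_mem_nhds h3)] with
    x hx1 hx2 hx3 t ht hut
  by_contra hUt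
  obtain ⟨r, hr, hrU⟩ := φ.exists_mem_frontier (hx1 T ⟨le_rfl, by linarith⟩) hUt
  rw [uIcc_of_le ht] at hr
  have hrK := hκK _ ⟨hrU, hut.trans (L.antitone x hr.2), (L.antitone x hr.1).trans hx3.le⟩
  rw [← φ.map_add] at hrK
  -- An exit after `T + 1` would need a value at least `κ` at a time past `T`, where `h` is already
  -- below `κ`; an earlier exit contradicts the tube.
  have hrT : r ≤ T + 1 := by
    by_contra hlt
    exact absurd (hrK.trans (L.antitone x (show T ≤ -1 + r by linarith))) (not_le.2 hx2)
  rw [hU.frontier_eq] at hrU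
  exact hrU.2 (hx1 r ⟨hr.1, hrT⟩)

/-- The points `y i` are low enough to be reached only after the time `T`, and not below the level
of `y₀` by adjacency, so they lie in `U` or are rest points in its closure. The frontier contains no
rest point in that range. -/
theorem tendsto_of_conn_atTop {ι : Type*} {l : Filter ι} {x y : ι → M} {x₀ y₀ : M}
    (hx : Tendsto x l (𝓝 x₀)) (hc : ∀ᶠ i in l, FlowConn φ (x i) (y i))
    (hD : ∀ᶠ i in l, LevelAdj h C (x i) (h (y i)))
    (hy : Tendsto (fun i => h (y i)) l (𝓝 (h y₀))) (hx₀ : x₀ ∉ C)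
    (h0 : Tendsto (fun t => φ t x₀) atTop (𝓝 y₀)) : Tendsto y l (𝓝 y₀) := by
  rw [tendsto_iff_forall_eventually_mem]
  intro W hW
  obtain ⟨U, hUW, hU, huU, hd⟩ :=
    (L.finite (h y₀) (h x₀)).exists_isOpen_frontier_disjoint hW
  obtain ⟨T, hT⟩ := L.eventually_mem_of_tendsto_atTop hx₀ h0 hU huU hd
  have hlt := L.lt_of_tendsto_atTop hx₀ h0
  have hlt0 : h y₀ < h x₀ := by simpa [φ.map_zero_apply] using hlt 0
  have hcT : Tendsto (fun i => h (φ T (x i))) l (𝓝 (h (φ T x₀))) :=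
    ((L.cont.comp (φ.continuous_toFun T)).tendsto x₀).comp hx
  filter_upwards [hx.eventually hT, hc, hD, hy.eventually_lt hcT (hlt T),
    hy.eventually (gt_mem_nhds hlt0),
    ((L.cont.tendsto x₀).comp hx).eventually (lt_mem_nhds hlt0)] with i h1 h2 h3 h4 h5 h6
  apply hUW
  have hxi := h3.notMem
  have hge : h y₀ ≤ h (y i) := (h3 y₀ (L.mem_of_tendsto_atTop h0)).2.2 h6
  rcases h2 with ⟨t, ht⟩ | h2 | h2
  · rw [← ht] at h4 hge ⊢
    exact h1 t (le_of_lt ((L.strictAnti _ hxi).lt_iff_gt.1 h4)) hge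
  · have hcl : y i ∈ closure U := mem_closure_of_tendsto h2 ((eventually_ge_atTop T).mono
      fun t ht => h1 t ht (hge.trans (L.lt_of_tendsto_atTop hxi h2 t).le))
    by_contra hyU
    exact hd.le_bot ⟨by rw [hU.frontier_eq]; exact ⟨hcl, hyU⟩, L.mem_of_tendsto_atTop h2,
      hge, h5.le⟩
  · exact absurd (h4.trans (L.lt_of_tendsto_atBot hxi h2 T)) (lt_irrefl _)

/-- The point of a trajectory on a given level depends continuously on the trajectory and the
level, up to and including the neighbouring critical levels. -/
theorem tendsto_of_conn {ι : Type*} {l : Filter ι} {x y : ι → M} {x₀ y₀ : M}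
    (hx : Tendsto x l (𝓝 x₀)) (hc : ∀ᶠ i in l, FlowConn φ (x i) (y i))
    (hD : ∀ᶠ i in l, LevelAdj h C (x i) (h (y i)))
    (hy : Tendsto (fun i => h (y i)) l (𝓝 (h y₀))) (hx₀ : x₀ ∉ C)
    (h0 : FlowConn φ x₀ y₀) : Tendsto y l (𝓝 y₀) := by
  rcases h0 with ⟨τ, rfl⟩ | h0 | h0
  · rw [tendsto_iff_forall_eventually_mem]
    intro W hW
    have hcont : Continuous fun q : ℝ × M => φ q.1 q.2 := φ.continuous continuous_fst continuous_snd
    obtain ⟨u, hu, w, hw, huw⟩ := mem_nhds_prod_iff.1 (hcont.continuousAt (x := (τ, x₀)) hW)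
    obtain ⟨η, hη, hηu⟩ := Metric.mem_nhds_iff.1 hu
    have hlev : ∀ t, Tendsto (fun i => h (φ t (x i))) l (𝓝 (h (φ t x₀))) := fun t =>
      ((L.cont.comp (φ.continuous_toFun t)).tendsto x₀).comp hx
    -- The level of `y i` lies between the levels reached at the times `τ ± η / 2`, so `y i` is
    -- reached at a time within `η` of `τ`.
    filter_upwards [hx.eventually hw, hc, hD,
      hy.eventually_lt (hlev (τ - η / 2)) (L.strictAnti x₀ hx₀ (by linarith)),
      (hlev (τ + η / 2)).eventually_lt hy (L.strictAnti x₀ hx₀ (by linarith))] with i h1 h2 h3 h4 h5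
    have hc : ContinuousOn (fun t => h (φ t (x i))) (Icc (τ - η / 2) (τ + η / 2)) :=
      (L.cont.comp (φ.continuous continuous_id continuous_const)).continuousOn
    obtain ⟨r, hr, hre⟩ := intermediate_value_Icc' (by linarith) hc ⟨h5.le, h4.le⟩
    rw [L.conn_unique h3.notMem h2 (.inl ⟨r, rfl⟩) hre.symm]
    refine huw (mk_mem_prod (hηu ?_) h1)
    rw [Metric.mem_ball, Real.dist_eq, abs_lt]
    constructor <;> linarith [hr.1, hr.2]
  · exact L.tendsto_of_conn_atTop hx hc hD hy hx₀ h0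
  · exact L.reverse.tendsto_of_conn_atTop hx (hc.mono fun i hi => hi.reverse)
      (hD.mono fun i hi => hi.neg) hy.neg hx₀ (h0.comp tendsto_neg_atTop_atBot)

end IsLyapunov

end Dynamics

/-! ### The flow of a Morse–Smale pair and its rest points -/

section CurveDerivative

variable {n : ℕ} {M : Type*} [TopologicalSpace M] [ChartedSpace (Rn n) M]

theorem HasMFDerivAt.hasDerivAt_comp {F : Type*} [NormedAddCommGroup F] [NormedSpace ℝ F]
    {c : ℝ → M} {t : ℝ} {ξ : TangentSpace (𝓡 n) (c t)} {g : M → F}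
    (hc : HasMFDerivAt 𝓘(ℝ, ℝ) (𝓡 n) c t
      ((1 : ℝ →L[ℝ] ℝ).smulRight (ξ : Rn n) : ℝ →L[ℝ] Rn n))
    (hg : MDifferentiableAt (𝓡 n) 𝓘(ℝ, F) g (c t)) :
    HasDerivAt (g ∘ c) (mvfderiv (𝓡 n) g (c t) ξ) t := by
  have h1 : HasFDerivAt (g ∘ c) (((mvfderiv (𝓡 n) g (c t) : Rn n →L[ℝ] F)).comp
      ((1 : ℝ →L[ℝ] ℝ).smulRight (ξ : Rn n) : ℝ →L[ℝ] Rn n)) t :=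
    (hg.hasMFDerivAt.comp t hc).hasFDerivAt
  refine h1.hasDerivAt.congr_deriv ?_
  change (mvfderiv (𝓡 n) g (c t) : Rn n →L[ℝ] F) ((1 : ℝ) • (ξ : Rn n)) = _
  rw [one_smul]

end CurveDerivative

namespace MorseSmalePair

universe u

variable {n : ℕ} {M : Type u} [TopologicalSpace M] [ChartedSpace (Rn n) M]
  [IsManifold (𝓡 n) ∞ M] (P : MorseSmalePair n M)

theorem flow_zero (x : M) : P.flow 0 x = x := (P.complete x).choose_spec.1

theorem isMIntegralCurve_flow (x : M) : IsMIntegralCurve (fun t => P.flow t x) P.X :=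
  (P.complete x).choose_spec.2

/-- The set of critical points, as a subset of `M`. -/
def critSet : Set M := {v | IsCritical (n := n) P.h v}

theorem mdifferentiableAt_h (x : M) : MDifferentiableAt (𝓡 n) 𝓘(ℝ, ℝ) P.h x :=
  P.smooth_h.mdifferentiableAt (by simp)

theorem hasDerivAt_h_flow (x : M) (t : ℝ) :
    HasDerivAt (fun t => P.h (P.flow t x))
      (mvfderiv (𝓡 n) P.h (P.flow t x) (P.X (P.flow t x))) t :=
  (P.isMIntegralCurve_flow x t).hasDerivAt_comp (P.mdifferentiableAt_h _)

variable [T2Space M]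

/-- The flow of `X`, as a continuous action of `ℝ`. -/
def phi : Flow ℝ M :=
  (exists_flow_of_complete (P.smooth_X.of_le (by norm_cast))
    fun x => ⟨P.flow_zero x, P.isMIntegralCurve_flow x⟩).choose

theorem phi_apply (t : ℝ) (x : M) : P.phi t x = P.flow t x :=
  (exists_flow_of_complete (P.smooth_X.of_le (by norm_cast))
    fun x => ⟨P.flow_zero x, P.isMIntegralCurve_flow x⟩).choose_spec.1 t x

theorem mdifferentiable_phi (t : ℝ) : MDifferentiable (𝓡 n) (𝓡 n) (P.phi t) :=
  (exists_flow_of_complete (P.smooth_X.of_le (by norm_cast))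
    fun x => ⟨P.flow_zero x, P.isMIntegralCurve_flow x⟩).choose_spec.2 t

theorem isMIntegralCurve_phi (x : M) : IsMIntegralCurve (fun t => P.phi t x) P.X := by
  simp_rw [phi_apply]
  exact P.isMIntegralCurve_flow x

theorem eq_phi {c : ℝ → M} (hc : IsMIntegralCurve c P.X) (t : ℝ) : c t = P.phi t (c 0) :=
  congrFun (isMIntegralCurve_Ioo_eq_of_contMDiff_boundaryless (t₀ := 0)
    (P.smooth_X.of_le (by norm_cast)) hc (P.isMIntegralCurve_phi (c 0))
    (P.phi.map_zero_apply _).symm) t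

theorem mem_limitSet {l : Filter ℝ} {v x : M} :
    x ∈ limitSet P.X l v ↔ Tendsto (fun t => P.phi t x) l (𝓝 v) := by
  constructor
  · rintro ⟨c, rfl, hc, h⟩
    simpa only [← P.eq_phi hc] using h
  · exact fun h => ⟨fun t => P.phi t x, P.phi.map_zero_apply x, P.isMIntegralCurve_phi x, h⟩

theorem mem_Wminus {v : P.Crit} {x : M} :
    x ∈ P.Wminus v ↔ Tendsto (fun t => P.phi t x) atBot (𝓝 v.1) := P.mem_limitSet

theorem mem_Wplus {v : P.Crit} {x : M} :
    x ∈ P.Wplus v ↔ Tendsto (fun t => P.phi t x) atTop (𝓝 v.1) := P.mem_limitSet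

omit [IsManifold (𝓡 n) ∞ M] [T2Space M] in
theorem mdifferentiableAt_chart {e : OpenPartialHomeomorph M (Rn n)}
    (he : e ∈ IsManifold.maximalAtlas (𝓡 n) ∞ M) {y : M} (hy : y ∈ e.source) :
    MDifferentiableAt (𝓡 n) (𝓡 n) e y :=
  (contMDiffAt_of_mem_maximalAtlas he hy).mdifferentiableAt (by simp)

theorem hasDerivAt_chart_phi {e : OpenPartialHomeomorph M (Rn n)}
    (he : e ∈ IsManifold.maximalAtlas (𝓡 n) ∞ M) {x : M} {t : ℝ}
    (hy : P.phi t x ∈ e.source) :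
    HasDerivAt (fun t => e (P.phi t x))
      (mvfderiv (𝓡 n) e (P.phi t x) (P.X (P.phi t x))) t :=
  (P.isMIntegralCurve_phi x t).hasDerivAt_comp (mdifferentiableAt_chart he hy)

/-- The standard field vanishes at the centre of the chart and the differential of a chart is
injective, so `X` vanishes at `v`. -/
theorem phi_of_critical {v : M} (hv : v ∈ P.critSet) (t : ℝ) : P.phi t v = v := by
  obtain ⟨e, he, r, hr, hve, hev, -, hst⟩ := P.gradientLike.standard v hv
  have hdiff : e.MDifferentiable (𝓡 n) (𝓡 n) :=
    ⟨(contMDiffOn_of_mem_maximalAtlas he).mdifferentiableOn (by simp),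
      (contMDiffOn_symm_of_mem_maximalAtlas he).mdifferentiableOn (by simp)⟩
  have h1 := (hst v hve).2
  have h0 : modelField (morseIndex (n := n) P.h v) (0 : Rn n) = 0 := by
    ext j; simp [modelField]
  rw [hev, h0] at h1
  have hX : P.X v = 0 := by
    refine hdiff.mfderiv_injective hve ?_
    rw [map_zero]
    exact h1
  exact (P.eq_phi (isMIntegralCurve_const hX) t).symm

omit [T2Space M] in
theorem hasDerivAt_modelFun {k : ℕ} {c : ℝ → Rn n} {t : ℝ}
    (hc : HasDerivAt c (modelField k (c t)) t) :
    HasDerivAt (fun t => modelFun k (c t)) (-∑ j, (c t) j ^ 2) t := by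
  have hj : ∀ j, HasDerivAt (fun t => c t j) (modelField k (c t) j) t := fun j =>
    ((EuclideanSpace.proj j : Rn n →L[ℝ] ℝ).hasFDerivAt (x := c t)).comp_hasDerivAt t hc
  have h1 : ∀ s : Finset (Fin n), HasDerivAt (fun t => ∑ j ∈ s, c t j ^ 2)
      (∑ j ∈ s, 2 * (c t j * modelField k (c t) j)) t := fun s => by
    refine HasDerivAt.fun_sum fun j _ => ?_
    refine ((hj j).fun_pow 2).congr_deriv ?_
    simp [mul_assoc]
  have h2 := ((h1 (Finset.univ.filter fun j : Fin n => (j : ℕ) < k)).const_mul (-(1 / 2))).add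
    ((h1 (Finset.univ.filter fun j : Fin n => k ≤ (j : ℕ))).const_mul (1 / 2))
  refine h2.congr_deriv ?_
  rw [← Finset.sum_filter_add_sum_filter_not Finset.univ (fun j : Fin n => (j : ℕ) < k)
    (fun j => c t j ^ 2)]
  simp only [not_lt]
  rw [Finset.mul_sum, Finset.mul_sum, neg_add, ← Finset.sum_neg_distrib, ← Finset.sum_neg_distrib]
  congr 1
  · refine Finset.sum_congr rfl fun j hj => ?_
    rw [Finset.mem_filter] at hj
    simp only [modelField, hj.2, if_true]
    ring
  · refine Finset.sum_congr rfl fun j hj => ?_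
    rw [Finset.mem_filter] at hj
    simp only [modelField, not_lt.2 hj.2, if_false]
    ring

/-- Every critical point is the only one in some neighbourhood. -/
theorem eventually_eq_of_critical {v : M} (hv : v ∈ P.critSet) :
    ∀ᶠ y in 𝓝 v, y ∈ P.critSet → y = v := by
  obtain ⟨e, he, r, hr, hve, hev, -, hst⟩ := P.gradientLike.standard v hv
  filter_upwards [e.open_source.mem_nhds hve] with y hy hyC
  have h0 : P.phi 0 y = y := P.phi.map_zero_apply y
  have h1 : HasDerivAt (fun t => e (P.phi t y))
      (modelField (morseIndex (n := n) P.h v) (e (P.phi 0 y))) 0 := by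
    rw [← (hst (P.phi 0 y) (h0.symm ▸ hy)).2]
    exact P.hasDerivAt_chart_phi he (by rwa [h0])
  have h2 := (hasDerivAt_modelFun h1).const_add (P.h v)
  -- A critical point is at rest, so `h` is constant along its trajectory. In the chart of `v` the
  -- derivative is minus the squared norm of the coordinate vector, which must therefore be zero.
  have hconst : (fun t => P.h v + modelFun (morseIndex (n := n) P.h v) (e (P.phi t y))) =
      fun _ => P.h y := funext fun t => by
    rw [P.phi_of_critical hyC, (hst y hy).1]
  rw [hconst] at h2
  have h3 := h2.unique (hasDerivAt_const (0 : ℝ) (P.h y))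
  rw [neg_eq_zero, Finset.sum_eq_zero_iff_of_nonneg fun j _ => sq_nonneg _, h0] at h3
  refine e.injOn hy hve ?_
  rw [hev]
  ext j
  simpa using h3 j (Finset.mem_univ j)

/-- Critical points are fixed by the flow, so the orbit of a noncritical point contains none and the
derivative of `h` is negative all along it. -/
theorem strictAnti_h_phi {x : M} (hx : x ∉ P.critSet) : StrictAnti fun t => P.h (P.phi t x) := by
  refine strictAnti_of_deriv_neg fun t => ?_
  simp_rw [phi_apply]
  rw [(P.hasDerivAt_h_flow x t).deriv]
  refine P.gradientLike.neg _ fun hC => hx ?_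
  have h1 := P.phi_of_critical hC (-t)
  rw [← phi_apply, ← P.phi.map_add, neg_add_cancel, P.phi.map_zero_apply] at h1
  rw [h1, phi_apply]
  exact hC

theorem isLyapunov : IsLyapunov P.phi P.h P.critSet where
  cont := P.smooth_h.continuous
  compact _ _ := P.proper_h.isCompact_preimage isCompact_Icc
  fixed _ hx t := P.phi_of_critical hx t
  strictAnti _ hx := P.strictAnti_h_phi hx
  finite a b := by
    -- An accumulation point of critical points cannot be critical, as these are isolated, nor
    -- noncritical, as being moved by the time-one map is an open condition.
    by_contra hinf
    obtain ⟨z, -, hz⟩ := Set.Infinite.exists_accPt_of_subset_isCompact hinf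
      (P.proper_h.isCompact_preimage (isCompact_Icc (a := a) (b := b))) inter_subset_right
    rw [accPt_iff_frequently] at hz
    by_cases hzC : z ∈ P.critSet
    · obtain ⟨y, ⟨hyz, hy⟩, hy'⟩ := (hz.and_eventually (P.eventually_eq_of_critical hzC)).exists
      exact hyz (hy' hy.1)
    · have hne : P.phi 1 z ≠ z := fun h1 => by
        have := P.strictAnti_h_phi hzC zero_lt_one
        simp [h1, P.phi.map_zero_apply] at this
      have hopen : IsOpen {y | P.phi 1 y ≠ y} :=
        isOpen_ne_fun (P.phi.continuous_toFun 1) continuous_id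
      obtain ⟨y, ⟨-, hy⟩, hy'⟩ := (hz.and_eventually (hopen.mem_nhds hne)).exists
      exact hy' (P.phi_of_critical hy.1 1)

end MorseSmalePair

/-! ### Unstable manifolds in standard charts -/

section StandardChart

variable {n : ℕ} {M : Type*} [TopologicalSpace M]

/-- `e` is a chart onto a ball centred at `v` in which the function `f` and the flow `φ` take the
standard form, with expanding coordinates those in `J`. -/
structure IsStandardChart (φ : Flow ℝ M) (f : M → ℝ) (v : M) (e : OpenPartialHomeomorph M (Rn n))
    (r : ℝ) (J : Finset (Fin n)) : Prop where
  antitone : ∀ x, Antitone fun t => f (φ t x)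
  mem_source : v ∈ e.source
  map_center : e v = 0
  target : e.target = Metric.ball 0 r
  eq : ∀ y ∈ e.source,
    f y = f v + (-(1 / 2) * ∑ j ∈ J, e y j ^ 2 + 1 / 2 * ∑ j ∈ Jᶜ, e y j ^ 2)
  deriv : ∀ x t, φ t x ∈ e.source → ∀ j,
    HasDerivAt (fun t => e (φ t x) j) (if j ∈ J then e (φ t x) j else -e (φ t x) j) t

theorem mul_exp_eq_of_hasDerivAt_neg {g : ℝ → ℝ} {a b : ℝ}
    (hg : ∀ s ∈ Icc a b, HasDerivAt g (-g s) s) :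
    ∀ s ∈ Icc a b, g s * Real.exp s = g a * Real.exp a := by
  have hd : ∀ s ∈ Icc a b, HasDerivAt (fun s => g s * Real.exp s) 0 s := fun s hs =>
    ((hg s hs).mul (Real.hasDerivAt_exp s)).congr_deriv (by ring)
  exact constant_of_has_deriv_right_zero
    (fun s hs => (hd s hs).continuousAt.continuousWithinAt)
    fun s hs => (hd s (Ico_subset_Icc_self hs)).hasDerivWithinAt

/-- In a standard chart, the unstable manifold is contained in the plane of the expanding
coordinates. -/
theorem IsStandardChart.coord_eq_zero [T2Space M] {φ : Flow ℝ M} {f : M → ℝ} {v : M}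
    {e : OpenPartialHomeomorph M (Rn n)} {r : ℝ} {J : Finset (Fin n)}
    (S : IsStandardChart φ f v e r J) {y : M} (hy : y ∈ e.source)
    (hyv : Tendsto (fun t => φ t y) atBot (𝓝 v)) : ∀ j ∉ J, e y j = 0 := by
  have hφ : Continuous fun t => φ t y := φ.continuous continuous_id continuous_const
  have hsrc : ∀ᶠ t in atBot, φ t y ∈ e.source := hyv.eventually (e.open_source.mem_nhds S.mem_source)
  obtain ⟨T₀, hT₀⟩ := eventually_atBot.1 hsrc
  set T := min T₀ 0
  have hT : ∀ t ≤ T, φ t y ∈ e.source := fun t ht => hT₀ t (ht.trans (min_le_left _ _))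
  have hder : ∀ t, φ t y ∈ e.source → ∀ j ∉ J,
      HasDerivAt (fun t => e (φ t y) j) (-e (φ t y) j) t := fun t ht j hj => by
    simpa [hj] using S.deriv y t ht j
  -- Near time `-∞` the orbit is in the chart and a contracting coordinate times `exp t` is
  -- constant; it tends to `0`, so it is `0`.
  have hzT : ∀ j ∉ J, e (φ T y) j = 0 := fun j hj => by
    have hlim : Tendsto (fun t => e (φ t y) j * Real.exp t) atBot (𝓝 0) := by
      have h1 : Tendsto (fun t => e (φ t y) j) atBot (𝓝 (e v j)) :=
        ((EuclideanSpace.proj j : Rn n →L[ℝ] ℝ).continuous.tendsto _).comp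
          ((e.continuousAt S.mem_source).tendsto.comp hyv)
      simpa using h1.mul Real.tendsto_exp_atBot
    have hconst : ∀ t ≤ T, e (φ t y) j * Real.exp t = e (φ T y) j * Real.exp T := fun t ht =>
      (mul_exp_eq_of_hasDerivAt_neg (g := fun t => e (φ t y) j) (a := t) (b := T)
        (fun s hs => hder s (hT s hs.2) j hj) T ⟨ht, le_rfl⟩).symm
    have h2 := tendsto_nhds_unique (hlim.congr' ((eventually_le_atBot T).mono hconst))
      tendsto_const_nhds
    exact (mul_eq_zero.1 h2.symm).resolve_right (Real.exp_pos T).ne'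
  set ρ := ‖e y‖ with hρ
  have hρr : ρ < r := by
    have := e.map_source hy
    rwa [S.target, mem_ball_zero_iff] at this
  set Z : Set (Rn n) := {z | ∀ j ∉ J, z j = 0} with hZ
  have hZc : IsClosed Z := by
    simp only [hZ, Set.ofPred_forall]
    exact isClosed_iInter fun j => isClosed_iInter fun _ =>
      isClosed_eq (EuclideanSpace.proj j : Rn n →L[ℝ] ℝ).continuous continuous_const
  have hball : Metric.closedBall (0 : Rn n) ρ ∩ Z ⊆ e.target := fun z hz => by
    rw [S.target]
    exact Metric.closedBall_subset_ball hρr hz.1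
  have hKc : IsClosed (e.symm '' (Metric.closedBall (0 : Rn n) ρ ∩ Z)) :=
    (((isCompact_closedBall (0 : Rn n) ρ).inter_right hZc).image_of_continuousOn
      (e.continuousOn_symm.mono hball)).isClosed
  have hnorm : ∀ z : Rn n, ‖z‖ ^ 2 = ∑ j ∈ J, z j ^ 2 + ∑ j ∈ Jᶜ, z j ^ 2 := fun z => by
    rw [EuclideanSpace.real_norm_sq_eq, Finset.sum_add_sum_compl]
  -- The orbit might leave the chart and return between `T` and `0`; continuous induction excludes
  -- this. While the contracting coordinates vanish, monotonicity of `f` bounds the norm by `‖e y‖ <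
  -- r`, so the good set of times is closed in the interval. The linear equation extends it to the
  -- right.
  have hsubset : Icc T 0 ⊆ {t | φ t y ∈ e.source ∧ ∀ j ∉ J, e (φ t y) j = 0} := by
    refine IsClosed.Icc_subset_of_forall_mem_nhdsWithin ?_ ⟨hT T le_rfl, hzT⟩ ?_
    · have heq : {t | φ t y ∈ e.source ∧ ∀ j ∉ J, e (φ t y) j = 0} ∩ Icc T 0 =
          (fun t => φ t y) ⁻¹' (e.symm '' (Metric.closedBall (0 : Rn n) ρ ∩ Z)) ∩ Icc T 0 := by
        ext t
        constructor
        · rintro ⟨⟨h1, h2⟩, ht⟩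
          refine ⟨⟨e (φ t y), ⟨?_, h2⟩, e.left_inv h1⟩, ht⟩
          rw [mem_closedBall_zero_iff]
          have h3 : f y ≤ f (φ t y) := by
            simpa [φ.map_zero_apply] using S.antitone y ht.2
          rw [S.eq _ h1, S.eq _ hy] at h3
          have h4 : ∑ j ∈ Jᶜ, e (φ t y) j ^ 2 = 0 := Finset.sum_eq_zero fun j hj => by
            rw [h2 j (Finset.mem_compl.1 hj)]; norm_num
          have h5 : 0 ≤ ∑ j ∈ Jᶜ, e y j ^ 2 := Finset.sum_nonneg fun j _ => sq_nonneg _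
          refine abs_le_of_sq_le_sq' ?_ (norm_nonneg _) |>.2
          rw [hnorm, hnorm, h4]
          linarith
        · rintro ⟨⟨z, hz, hzt⟩, ht⟩
          simp only at hzt
          refine ⟨⟨?_, ?_⟩, ht⟩
          · rw [← hzt]; exact e.map_target (hball hz)
          · rw [← hzt, e.right_inv (hball hz)]; exact hz.2
      rw [heq]
      exact (hKc.preimage hφ).inter isClosed_Icc
    · rintro t ⟨⟨h1, h2⟩, -⟩
      obtain ⟨ε, hε, hεs⟩ := Metric.eventually_nhds_iff_ball.1
        (hφ.continuousAt.eventually (e.open_source.mem_nhds h1))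
      refine mem_of_superset (Ioo_mem_nhdsGT (show t < t + ε by linarith)) fun s hs => ?_
      have hmem : ∀ s' ∈ Icc t s, φ s' y ∈ e.source := fun s' hs' => hεs s' (by
        rw [Metric.mem_ball, Real.dist_eq, abs_lt]
        constructor <;> linarith [hs.2, hs'.1, hs'.2])
      refine ⟨hmem s ⟨hs.1.le, le_rfl⟩, fun j hj => ?_⟩
      have h3 := mul_exp_eq_of_hasDerivAt_neg (g := fun t => e (φ t y) j) (a := t) (b := s)
        (fun s' hs' => hder s' (hmem s' hs') j hj) s ⟨hs.1.le, le_rfl⟩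
      simp only [h2 j hj, zero_mul] at h3
      exact (mul_eq_zero.1 h3).resolve_right (Real.exp_pos s).ne'
  have := (hsubset ⟨min_le_right _ _, le_rfl⟩).2
  simpa [φ.map_zero_apply] using this

variable [ChartedSpace (Rn n) M] [T2Space M]

/-- The tangent vectors of the unstable manifold at a point span a space of dimension at most the
number of expanding coordinates. -/
theorem IsStandardChart.exists_submodule {φ : Flow ℝ M} {f : M → ℝ} {v : M}
    {e : OpenPartialHomeomorph M (Rn n)} {r : ℝ} {J : Finset (Fin n)}
    (S : IsStandardChart φ f v e r J) (he : e ∈ IsManifold.maximalAtlas (𝓡 n) ∞ M)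
    (hφ : ∀ t, MDifferentiable (𝓡 n) (𝓡 n) (φ t)) {W : Set M}
    (hW : ∀ x, x ∈ W ↔ Tendsto (fun t => φ t x) atBot (𝓝 v)) {x : M} (hx : x ∈ W) :
    ∃ A : Submodule ℝ (Rn n), Module.finrank ℝ A ≤ J.card ∧
      ∀ ξ ∈ tangentVectors (n := n) W x, (ξ : Rn n) ∈ A := by
  have hinv : ∀ t, ∀ x ∈ W, φ t x ∈ W := fun t x hx => by
    rw [hW] at hx ⊢
    simp_rw [← φ.map_add]
    exact hx.comp (tendsto_atBot_add_const_right _ t tendsto_id)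
  obtain ⟨T, hT⟩ := (((hW x).1 hx).eventually (e.open_source.mem_nhds S.mem_source)).exists
  have hediff : e.MDifferentiable (𝓡 n) (𝓡 n) :=
    ⟨(contMDiffOn_of_mem_maximalAtlas he).mdifferentiableOn (by simp),
      (contMDiffOn_symm_of_mem_maximalAtlas he).mdifferentiableOn (by simp)⟩
  have hφe : MDifferentiableAt (𝓡 n) (𝓡 n) e (φ T x) :=
    (contMDiffAt_of_mem_maximalAtlas he hT).mdifferentiableAt (by simp)
  let D : Rn n →L[ℝ] Rn n := mvfderiv (𝓡 n) (e ∘ φ T) x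
  have hDinj : Function.Injective D := by
    have h1 : Function.Injective (mfderiv (𝓡 n) (𝓡 n) (φ T) x) := by
      have h2 := mfderiv_comp x (hφ (-T) (φ T x)) (hφ T x)
      have h3 : φ (-T) ∘ φ T = id := funext fun z => by
        simp [← φ.map_add, φ.map_zero_apply]
      rw [h3, mfderiv_id] at h2
      intro a b hab
      have h4 := congrArg (mfderiv (𝓡 n) (𝓡 n) (φ (-T)) (φ T x)) hab
      have h5 : ∀ a : TangentSpace (𝓡 n) x, a =
          mfderiv (𝓡 n) (𝓡 n) (φ (-T)) (φ T x) (mfderiv (𝓡 n) (𝓡 n) (φ T) x a) :=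
        fun a => congrArg (fun F : Rn n →L[ℝ] Rn n => F a) h2
      exact (h5 a).trans (h4.trans (h5 b).symm)
    have h6 : ∀ a : Rn n, D a =
        mfderiv (𝓡 n) (𝓡 n) e (φ T x) (mfderiv (𝓡 n) (𝓡 n) (φ T) x a) := fun a =>
      congrArg (fun F : Rn n →L[ℝ] Rn n => F a) (mfderiv_comp x hφe (hφ T x))
    intro a b hab
    rw [h6, h6] at hab
    exact h1 (hediff.mfderiv_injective hT hab)
  -- The preimage of the expanding plane under the derivative of `e ∘ φ T`, where `T` is a time at
  -- which the orbit of `x` is in the chart. Injectivity of the derivative bounds its dimension.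
  let A : Submodule ℝ (Rn n) :=
    { carrier := {ξ | ∀ j ∉ J, D ξ j = 0}
      add_mem' := fun {a b} ha hb j hj => by simp [ha j hj, hb j hj]
      zero_mem' := fun j _ => by simp
      smul_mem' := fun c a ha j hj => by simp [ha j hj] }
  refine ⟨A, ?_, ?_⟩
  · let R : A →ₗ[ℝ] (J → ℝ) :=
      { toFun := fun ξ j => D ξ.1 j
        map_add' := fun a b => by ext j; simp
        map_smul' := fun c a => by ext j; simp }
    have hR : Function.Injective R := fun a b hab => by
      refine Subtype.ext (hDinj ?_)
      ext j
      by_cases hj : j ∈ J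
      · exact congrFun hab ⟨j, hj⟩
      · rw [a.2 j hj, b.2 j hj]
    have := LinearMap.finrank_le_finrank_of_injective hR
    simpa using this
  · rintro ξ ⟨c, rfl, hcW, hc⟩ j hj
    have h1 := hc.hasDerivAt_comp (g := e ∘ φ T)
      (MDifferentiableAt.comp (c 0) hφe (hφ T (c 0)))
    have h2 := ((EuclideanSpace.proj j : Rn n →L[ℝ] ℝ).hasFDerivAt
      (x := ((e ∘ φ T) ∘ c) 0)).comp_hasDerivAt 0 h1
    have hcc : ContinuousAt (fun t => φ T (c t)) 0 :=
      (φ.continuous_toFun T).continuousAt.comp hc.continuousAt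
    -- A curve in `W` stays in the expanding plane after transport into the chart, so its
    -- contracting coordinates have zero derivative.
    have h3 : (fun t => e (φ T (c t)) j) =ᶠ[𝓝 0] fun _ => 0 := by
      filter_upwards [hcW, hcc.eventually (e.open_source.mem_nhds hT)] with t ht hts
      exact S.coord_eq_zero hts ((hW _).1 (hinv T _ ht)) j hj
    exact h2.unique ((hasDerivAt_const (0 : ℝ) (0 : ℝ)).congr_of_eventuallyEq h3)

end StandardChart

/-! ### Connecting orbits lower the index -/

namespace MorseSmalePair

universe u

variable {n : ℕ} {M : Type u} [TopologicalSpace M] [ChartedSpace (Rn n) M]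
  [IsManifold (𝓡 n) ∞ M] [T2Space M] (P : MorseSmalePair n M)

/-- The same chart is standard for the reversed flow and `-h` with complementary coordinates, so
results on unstable manifolds also cover stable ones. -/
theorem exists_isStandardChart (v : P.Crit) :
    ∃ e ∈ IsManifold.maximalAtlas (𝓡 n) ∞ M, ∃ r,
      IsStandardChart P.phi P.h v.1 e r
        (Finset.univ.filter fun j : Fin n => (j : ℕ) < v.index) ∧
      IsStandardChart P.phi.reverse (fun x => -P.h x) v.1 e r
        (Finset.univ.filter fun j : Fin n => (j : ℕ) < v.index)ᶜ := by
  obtain ⟨e, he, r, hr, hve, hev, htar, hst⟩ := P.gradientLike.standard v.1 v.2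
  have hder : ∀ x t, P.phi t x ∈ e.source → ∀ j : Fin n, HasDerivAt (fun t => e (P.phi t x) j)
      (if (j : ℕ) < v.index then e (P.phi t x) j else -e (P.phi t x) j) t := fun x t ht j => by
    have h1 := P.hasDerivAt_chart_phi he ht
    rw [(hst _ ht).2] at h1
    exact ((EuclideanSpace.proj j : Rn n →L[ℝ] ℝ).hasFDerivAt (x := e (P.phi t x))).comp_hasDerivAt
      t h1
  have hcompl : (Finset.univ.filter fun j : Fin n => (j : ℕ) < v.index)ᶜ =
      Finset.univ.filter fun j : Fin n => v.index ≤ (j : ℕ) := by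
    ext j; simp
  refine ⟨e, he, r, ⟨P.isLyapunov.antitone, hve, hev, htar, fun y hy => ?_, fun x t ht j => ?_⟩,
    ⟨P.isLyapunov.reverse.antitone, hve, hev, htar, fun y hy => ?_, fun x t ht j => ?_⟩⟩
  · rw [hcompl]; exact (hst y hy).1
  · simpa using hder x t ht j
  · rw [compl_compl, hcompl]
    have h1 : P.h y = P.h v.1 + modelFun v.index (e y) := (hst y hy).1
    rw [h1, modelFun]
    ring
  · have h1 := (hder x (-t) ht j).scomp t (hasDerivAt_neg t)
    refine h1.congr_deriv ?_
    by_cases hj : (j : ℕ) < v.index <;> simp [hj]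

/-- The Morse–Smale condition: a connecting orbit decreases the index. -/
theorem below_of_mem {v w : P.Crit} {x : M} (hxv : x ∈ P.Wminus v) (hxw : x ∈ P.Wplus w)
    (hx : x ∉ P.critSet) : w.Below v := by
  have L := P.isLyapunov
  refine ⟨?_, (L.lt_of_tendsto_atTop hx (P.mem_Wplus.1 hxw) 0).trans
    (L.lt_of_tendsto_atBot hx (P.mem_Wminus.1 hxv) 0)⟩
  obtain ⟨e, he, r, S, -⟩ := P.exists_isStandardChart v
  obtain ⟨e', he', r', -, S'⟩ := P.exists_isStandardChart w
  obtain ⟨A, hA, hAt⟩ := S.exists_submodule he P.mdifferentiable_phi (fun _ => P.mem_Wminus) hxv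
  obtain ⟨B, hB, hBt⟩ := S'.exists_submodule he' (fun t => P.mdifferentiable_phi (-t))
    (W := P.Wplus w) (fun y => by
      rw [P.mem_Wplus]
      exact ⟨fun h => h.comp tendsto_neg_atBot_atTop, fun h => by
        simpa [Function.comp_def] using h.comp tendsto_neg_atTop_atBot⟩) hxw
  -- Transversality makes `A` and `B` span, and both contain the nonzero vector `X x`. The
  -- dimensions then give `n + 1 ≤ dim A + dim B`.
  have hsup : A ⊔ B = ⊤ := by
    let V : Set (Rn n) := tangentVectors (n := n) (P.Wminus v) x ∪ tangentVectors (P.Wplus w) x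
    have h1 : Submodule.span ℝ V = ⊤ := P.morseSmale v.1 w.1 v.2 w.2 x ⟨hxv, hxw⟩
    have hV : V ⊆ (A ⊔ B : Submodule ℝ (Rn n)) := fun ξ hξ =>
      hξ.elim (fun h => Submodule.mem_sup_left (hAt ξ h))
        fun h => Submodule.mem_sup_right (hBt ξ h)
    exact top_le_iff.1 (h1.symm.le.trans (Submodule.span_le.2 hV))
  have hcurve : HasMFDerivAt 𝓘(ℝ, ℝ) (𝓡 n) (fun t => P.phi t x) 0
      ((1 : ℝ →L[ℝ] ℝ).smulRight (P.X x : Rn n) : ℝ →L[ℝ] Rn n) := by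
    have h1 : ∀ z, z = x → (P.X z : Rn n) = P.X x := by rintro _ rfl; rfl
    rw [← h1 _ (P.phi.map_zero_apply x)]
    exact P.isMIntegralCurve_phi x 0
  have hXA : (P.X x : Rn n) ∈ A := hAt _ ⟨fun t => P.phi t x, P.phi.map_zero_apply x,
    Eventually.of_forall fun t => by
      rw [P.mem_Wminus] at hxv ⊢
      simp_rw [← P.phi.map_add]
      exact hxv.comp (tendsto_atBot_add_const_right _ t tendsto_id), hcurve⟩
  have hXB : (P.X x : Rn n) ∈ B := hBt _ ⟨fun t => P.phi t x, P.phi.map_zero_apply x,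
    Eventually.of_forall fun t => by
      rw [P.mem_Wplus] at hxw ⊢
      simp_rw [← P.phi.map_add]
      exact hxw.comp (tendsto_atTop_add_const_right _ t tendsto_id), hcurve⟩
  have hX0 : (P.X x : Rn n) ≠ 0 := fun h0 => by
    have h1 := P.gradientLike.neg x hx
    have h2 : P.X x = 0 := h0
    rw [h2, map_zero] at h1
    exact lt_irrefl _ h1
  have hinf : 1 ≤ Module.finrank ℝ (A ⊓ B : Submodule ℝ (Rn n)) := by
    rw [Submodule.one_le_finrank_iff]
    exact fun hbot => hX0 ((Submodule.mem_bot ℝ).1 (hbot ▸ ⟨hXA, hXB⟩))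
  have hdim := Submodule.finrank_sup_add_finrank_inf_eq A B
  rw [hsup, finrank_top, finrank_euclideanSpace_fin] at hdim
  by_contra hle
  push Not at hle
  -- Comparing the sets of expanding coordinates themselves avoids having to know that the indices
  -- are at most `n`.
  have hmono := Finset.card_le_card (Finset.monotone_filter_right (Finset.univ : Finset (Fin n))
    (p := fun j => (j : ℕ) < v.index) (q := fun j => (j : ℕ) < w.index)
    fun j _ hj => hj.trans_le hle)
  have hcard := Finset.card_add_card_compl (Finset.univ.filter fun j : Fin n => (j : ℕ) < w.index)
  rw [Fintype.card_fin] at hcard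
  omega

end MorseSmalePair

/-! ### Broken trajectories and their traces -/

namespace MorseSmalePair

universe u

variable {n : ℕ} {M : Type u} [TopologicalSpace M] [ChartedSpace (Rn n) M]
  [IsManifold (𝓡 n) ∞ M] {P : MorseSmalePair n M}

/-- A broken trajectory continued by an orbit. -/
def Broken.snoc : {v w u : P.Crit} → P.Broken v w → u.Below w → P.Traj w u → P.Broken v u
  | _, _, u, .const _, hlt, γ => .step hlt γ (.const u)
  | _, _, _, .step hlt' γ' β, hlt, γ => .step hlt' γ' (β.snoc hlt γ)

theorem Broken.subset_trace_snoc {v w u : P.Crit} (β : P.Broken v w) (hlt : u.Below w)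
    (γ : P.Traj w u) : β.trace ⊆ (β.snoc hlt γ).trace ∧ γ.1 ⊆ (β.snoc hlt γ).trace := by
  induction β with
  | const v =>
    simp only [snoc, trace]
    exact ⟨by simp, fun y hy => .inr (.inl hy)⟩
  | step hlt' γ' β ih =>
    simp only [snoc, trace]
    exact ⟨insert_subset_insert (union_subset_union_right _ (ih hlt γ).1),
      fun y hy => .inr (.inr ((ih hlt γ).2 hy))⟩

theorem Broken.val_le {v w : P.Crit} (β : P.Broken v w) : w.val ≤ v.val := by
  induction β with
  | const v => exact le_rfl
  | step hlt γ β ih => exact ih.trans hlt.2.le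

theorem Broken.below_or_eq {v w : P.Crit} (β : P.Broken v w) : w.Below v ∨ w = v := by
  induction β with
  | const v => exact .inr rfl
  | step hlt γ β ih =>
    rcases ih with ih | rfl
    · exact .inl ⟨ih.1.trans hlt.1, ih.2.trans hlt.2⟩
    · exact .inl hlt

theorem Broken.left_mem_trace {v w : P.Crit} (β : P.Broken v w) : v.1 ∈ β.trace := by
  cases β with
  | const v => exact rfl
  | step hlt γ β => exact .inl rfl

theorem Broken.right_mem_trace {v w : P.Crit} (β : P.Broken v w) : w.1 ∈ β.trace := by
  induction β with
  | const v => exact rfl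
  | step hlt γ β ih => exact .inr (.inr ih)

variable [T2Space M]

omit [T2Space M] in
theorem Crit.mem_critSet (v : P.Crit) : v.1 ∈ P.critSet := v.2

theorem mem_orbit {x y : M} : y ∈ P.orbit x ↔ ∃ t, P.phi t x = y := by
  simp [orbit, phi_apply]

theorem Wminus_eq_of_critical {v : P.Crit} {x : M} (hx : x ∈ P.Wminus v) (hC : x ∈ P.critSet) :
    x = v.1 := by
  rw [P.mem_Wminus] at hx
  simp_rw [P.phi_of_critical hC] at hx
  exact tendsto_nhds_unique tendsto_const_nhds hx

theorem Wplus_eq_of_critical {v : P.Crit} {x : M} (hx : x ∈ P.Wplus v) (hC : x ∈ P.critSet) :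
    x = v.1 := by
  rw [P.mem_Wplus] at hx
  simp_rw [P.phi_of_critical hC] at hx
  exact tendsto_nhds_unique tendsto_const_nhds hx

theorem phi_mem_Wminus {v : P.Crit} {x : M} (hx : x ∈ P.Wminus v) (t : ℝ) :
    P.phi t x ∈ P.Wminus v := by
  rw [P.mem_Wminus] at hx ⊢
  simp_rw [← P.phi.map_add]
  exact hx.comp (tendsto_atBot_add_const_right _ t tendsto_id)

theorem phi_mem_Wplus {v : P.Crit} {x : M} (hx : x ∈ P.Wplus v) (t : ℝ) :
    P.phi t x ∈ P.Wplus v := by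
  rw [P.mem_Wplus] at hx ⊢
  simp_rw [← P.phi.map_add]
  exact hx.comp (tendsto_atTop_add_const_right _ t tendsto_id)

theorem lt_val_of_mem_Wminus {v : P.Crit} {x : M} (hx : x ∈ P.Wminus v) (hC : x ∉ P.critSet) :
    P.h x < v.val := by
  simpa [P.phi.map_zero_apply, Crit.val] using
    P.isLyapunov.lt_of_tendsto_atBot hC (P.mem_Wminus.1 hx) 0

theorem val_lt_of_mem_Wplus {v : P.Crit} {x : M} (hx : x ∈ P.Wplus v) (hC : x ∉ P.critSet) :
    v.val < P.h x := by
  simpa [P.phi.map_zero_apply, Crit.val] using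
    P.isLyapunov.lt_of_tendsto_atTop hC (P.mem_Wplus.1 hx) 0

theorem le_val_of_mem_Wminus {v : P.Crit} {x : M} (hx : x ∈ P.Wminus v) : P.h x ≤ v.val := by
  by_cases hC : x ∈ P.critSet
  · exact (congrArg P.h (Wminus_eq_of_critical hx hC)).le
  · exact (lt_val_of_mem_Wminus hx hC).le

theorem orbit_eq_of_mem {x y : M} (h : y ∈ P.orbit x) : P.orbit x = P.orbit y := by
  obtain ⟨t, rfl⟩ := mem_orbit.1 h
  ext z
  simp only [mem_orbit, ← P.phi.map_add]
  constructor
  · rintro ⟨s, rfl⟩; exact ⟨s - t, by simp⟩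
  · rintro ⟨s, rfl⟩; exact ⟨s + t, rfl⟩

/-- A critical point on the orbit would be fixed, hence equal to both `v` and `v₁`, which lie on
different levels. -/
theorem Traj.spec {v v₁ : P.Crit} (hlt : v₁.Below v) (γ : P.Traj v v₁) {y : M} (hy : y ∈ γ.1) :
    y ∉ P.critSet ∧ y ∈ P.Wminus v ∧ y ∈ P.Wplus v₁ ∧ γ.1 = P.orbit y := by
  obtain ⟨_, x, ⟨h1, h2⟩, rfl⟩ := γ
  obtain ⟨t, rfl⟩ := mem_orbit.1 hy
  refine ⟨fun hC => ?_, phi_mem_Wminus h1 t, phi_mem_Wplus h2 t, orbit_eq_of_mem hy⟩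
  have h3 := congrArg P.h ((Wminus_eq_of_critical (phi_mem_Wminus h1 t) hC).symm.trans
    (Wplus_eq_of_critical (phi_mem_Wplus h2 t) hC))
  exact absurd h3 hlt.2.ne'

theorem Traj.val_lt {v v₁ : P.Crit} (hlt : v₁.Below v) (γ : P.Traj v v₁) {y : M} (hy : y ∈ γ.1) :
    v₁.val < P.h y ∧ P.h y < v.val := by
  obtain ⟨h1, h2, h3, -⟩ := Traj.spec hlt γ hy
  exact ⟨val_lt_of_mem_Wplus h3 h1, lt_val_of_mem_Wminus h2 h1⟩

theorem Traj.exists_mem {v v₁ : P.Crit} (γ : P.Traj v v₁) {s : ℝ} (h1 : v₁.val < s)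
    (h2 : s < v.val) : ∃ y ∈ γ.1, P.h y = s := by
  obtain ⟨_, x, ⟨hv, hw⟩, rfl⟩ := γ
  have hc := P.isLyapunov.cont
  obtain ⟨a, ha⟩ := (((hc.tendsto _).comp (P.mem_Wplus.1 hw)).eventually (gt_mem_nhds h1)).exists
  obtain ⟨b, hb⟩ := (((hc.tendsto _).comp (P.mem_Wminus.1 hv)).eventually (lt_mem_nhds h2)).exists
  obtain ⟨t, ht⟩ := mem_range_of_exists_le_of_exists_ge
    (hc.comp (P.phi.continuous continuous_id continuous_const)) ⟨a, ha.le⟩ ⟨b, hb.le⟩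
  exact ⟨_, mem_orbit.2 ⟨t, rfl⟩, ht⟩

namespace Broken

theorem mem_Icc_of_mem_trace {v w : P.Crit} (β : P.Broken v w) {y : M} (hy : y ∈ β.trace) :
    P.h y ∈ Icc w.val v.val := by
  induction β with
  | const v => rw [trace, mem_singleton_iff] at hy; subst hy; exact ⟨le_rfl, le_rfl⟩
  | step hlt γ β ih =>
    rcases hy with rfl | hy | hy
    · exact ⟨β.val_le.trans hlt.2.le, le_rfl⟩
    · exact ⟨β.val_le.trans (Traj.val_lt hlt γ hy).1.le, (Traj.val_lt hlt γ hy).2.le⟩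
    · exact ⟨(ih hy).1, (ih hy).2.trans hlt.2.le⟩

theorem eq_of_mem_trace {v w : P.Crit} (β : P.Broken v w) {y y' : M} (hy : y ∈ β.trace)
    (hy' : y' ∈ β.trace) (heq : P.h y = P.h y') : y = y' := by
  induction β with
  | const v => rw [trace, mem_singleton_iff] at hy hy'; rw [hy, hy']
  | @step v v₁ w hlt γ β ih =>
    have hb : ∀ {z}, z ∈ β.trace → P.h z < v.val := fun hz =>
      (β.mem_Icc_of_mem_trace hz).2.trans_lt hlt.2
    rcases hy with rfl | hy | hy <;> rcases hy' with rfl | hy' | hy'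
    · rfl
    · exact absurd heq (Traj.val_lt hlt γ hy').2.ne'
    · exact absurd heq (hb hy').ne'
    · exact absurd heq (Traj.val_lt hlt γ hy).2.ne
    · obtain ⟨hC, -, -, horb⟩ := Traj.spec hlt γ hy
      rw [horb] at hy'
      exact P.isLyapunov.conn_unique hC (.refl _ _) (.inl (mem_orbit.1 hy')) heq
    · exact absurd heq ((β.mem_Icc_of_mem_trace hy').2.trans_lt (Traj.val_lt hlt γ hy).1).ne'
    · exact absurd heq (hb hy).ne
    · exact absurd heq ((β.mem_Icc_of_mem_trace hy).2.trans_lt (Traj.val_lt hlt γ hy').1).ne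
    · exact ih hy hy'

theorem exists_mem_trace {v w : P.Crit} (β : P.Broken v w) {s : ℝ} (hs : s ∈ Icc w.val v.val) :
    ∃ y ∈ β.trace, P.h y = s := by
  induction β with
  | const v => exact ⟨v.1, rfl, le_antisymm hs.1 hs.2⟩
  | @step v v₁ w hlt γ β ih =>
    rcases le_or_gt s v₁.val with h1 | h1
    · obtain ⟨y, hy, hys⟩ := ih ⟨hs.1, h1⟩
      exact ⟨y, .inr (.inr hy), hys⟩
    · rcases hs.2.lt_or_eq with h2 | h2
      · obtain ⟨y, hy, hys⟩ := Traj.exists_mem γ h1 h2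
        exact ⟨y, .inr (.inl hy), hys⟩
      · exact ⟨v.1, .inl rfl, h2.symm⟩

/-- The orbits in a trace occur whole, and both of their limits are among the critical points that
the trace includes. -/
theorem mem_trace_of_conn {v w : P.Crit} (β : P.Broken v w) {y z : M} (hy : y ∈ β.trace)
    (hyC : y ∉ P.critSet) (hz : FlowConn P.phi y z) : z ∈ β.trace := by
  induction β with
  | const v => rw [trace, mem_singleton_iff] at hy; exact absurd (hy ▸ v.2) hyC
  | step hlt γ β ih =>
    rcases hy with rfl | hy | hy
    · exact absurd (Crit.mem_critSet _) hyC
    · obtain ⟨-, h1, h2, h3⟩ := Traj.spec hlt γ hy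
      rcases hz with hz | hz | hz
      · exact .inr (.inl (h3 ▸ mem_orbit.2 hz))
      · rw [tendsto_nhds_unique hz (P.mem_Wplus.1 h2)]
        exact .inr (.inr β.left_mem_trace)
      · rw [tendsto_nhds_unique hz (P.mem_Wminus.1 h1)]
        exact .inl rfl
    · exact .inr (.inr (ih hy))

theorem mem_trace_step_iff {v v₁ w : P.Crit} {hlt : v₁.Below v} {γ : P.Traj v v₁}
    {β : P.Broken v₁ w} {y : M} :
    y ∈ β.trace ↔ y ∈ (Broken.step hlt γ β).trace ∧ P.h y ≤ v₁.val := by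
  refine ⟨fun hy => ⟨.inr (.inr hy), (β.mem_Icc_of_mem_trace hy).2⟩, ?_⟩
  rintro ⟨rfl | hy | hy, hle⟩
  · exact absurd hle (not_le.2 hlt.2)
  · exact absurd hle (not_le.2 (Traj.val_lt hlt γ hy).1)
  · exact hy

theorem mem_traj_of_mem_trace {v v₁ w : P.Crit} {hlt : v₁.Below v} {γ : P.Traj v v₁}
    {β : P.Broken v₁ w} {y : M} (hy : y ∈ (Broken.step hlt γ β).trace) (h1 : v₁.val < P.h y)
    (h2 : P.h y < v.val) : y ∈ γ.1 := by
  rcases hy with rfl | hy | hy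
  · exact absurd h2 (lt_irrefl _)
  · exact hy
  · exact absurd (β.mem_Icc_of_mem_trace hy).2 (not_le.2 h1)

/-- A broken trajectory is determined by its trace. -/
theorem trace_injective {v w : P.Crit} : Function.Injective (Broken.trace (v := v) (w := w)) := by
  intro β β' heq
  induction β with
  | const v =>
    cases β' with
    | const => rfl
    | step hlt γ β' => exact absurd (β'.val_le.trans_lt hlt.2) (lt_irrefl _)
  | @step v v₁ w hlt γ β ih =>
    cases β' with
    | const => exact absurd (β.val_le.trans_lt hlt.2) (lt_irrefl _)
    | @step _ v₁' _ hlt' γ' β' =>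
      -- On a level below `v` but above both candidates for the next critical point, the common
      -- trace has a point on both first orbits. That orbit determines `v₁` and `γ`.
      obtain ⟨s, hs1, hs2⟩ := exists_between (max_lt hlt.2 hlt'.2)
      obtain ⟨y, hy, rfl⟩ := Traj.exists_mem γ ((le_max_left _ _).trans_lt hs1) hs2
      have hyt : y ∈ (Broken.step hlt γ β).trace := .inr (.inl hy)
      have hy' : y ∈ γ'.1 :=
        mem_traj_of_mem_trace (heq ▸ hyt) ((le_max_right _ _).trans_lt hs1) hs2
      obtain ⟨-, -, h1, h2⟩ := Traj.spec hlt γ hy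
      obtain ⟨-, -, h1', h2'⟩ := Traj.spec hlt' γ' hy'
      obtain rfl : v₁ = v₁' :=
        Subtype.ext (tendsto_nhds_unique (P.mem_Wplus.1 h1) (P.mem_Wplus.1 h1'))
      obtain rfl : γ = γ' := Subtype.ext (h2.trans h2'.symm)
      obtain rfl : β = β' := ih (Set.ext fun z => by
        rw [mem_trace_step_iff (hlt := hlt) (γ := γ), heq, ← mem_trace_step_iff])
      rfl

end Broken

/-! ### Traces of elements of the completed unstable manifold -/

variable {v : P.Crit}

theorem mem_hatTrace {p : P.Hat v} {y : M} :
    y ∈ hatTrace v p ↔ y ∈ p.2.1.trace ∨ ∃ t ≤ 0, P.phi t (hatI v p) = y := by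
  simp [hatTrace, hatI, phi_apply]

theorem hatI_mem_hatTrace (p : P.Hat v) : hatI v p ∈ hatTrace v p :=
  mem_hatTrace.2 (.inr ⟨0, le_rfl, P.phi.map_zero_apply _⟩)

theorem left_mem_hatTrace (p : P.Hat v) : v.1 ∈ hatTrace v p :=
  mem_hatTrace.2 (.inl p.2.1.left_mem_trace)

omit [T2Space M] in
theorem hatI_mem_Wminus (p : P.Hat v) : hatI v p ∈ P.Wminus p.1.1 := p.2.2.2

theorem hatH_le_of_mem_hatTrace {p : P.Hat v} {y : M} (hy : y ∈ hatTrace v p) :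
    hatH v p ≤ P.h y := by
  rcases mem_hatTrace.1 hy with hy | ⟨t, ht, rfl⟩
  · exact (le_val_of_mem_Wminus (hatI_mem_Wminus p)).trans (p.2.1.mem_Icc_of_mem_trace hy).1
  · have := P.isLyapunov.antitone (hatI v p) ht
    simpa [P.phi.map_zero_apply, hatH] using this

theorem le_val_of_mem_hatTrace {p : P.Hat v} {y : M} (hy : y ∈ hatTrace v p) : P.h y ≤ v.val := by
  rcases mem_hatTrace.1 hy with hy | ⟨t, ht, rfl⟩
  · exact (p.2.1.mem_Icc_of_mem_trace hy).2
  · exact (le_val_of_mem_Wminus (phi_mem_Wminus (hatI_mem_Wminus p) t)).trans p.2.1.val_le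

theorem hatH_le_val (p : P.Hat v) : hatH v p ≤ v.val :=
  le_val_of_mem_hatTrace (hatI_mem_hatTrace p)

/-- The trace of the broken part consists of the points above the last critical point. -/
theorem mem_trace_iff {p : P.Hat v} {y : M} :
    y ∈ p.2.1.trace ↔ y ∈ hatTrace v p ∧ p.1.1.val ≤ P.h y := by
  refine ⟨fun hy => ⟨mem_hatTrace.2 (.inl hy), (p.2.1.mem_Icc_of_mem_trace hy).1⟩, ?_⟩
  rintro ⟨hy, hle⟩
  rcases mem_hatTrace.1 hy with hy | ⟨t, -, rfl⟩
  · exact hy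
  · have hW := phi_mem_Wminus (hatI_mem_Wminus p) t
    by_cases hC : P.phi t (hatI v p) ∈ P.critSet
    · rw [Wminus_eq_of_critical hW hC]
      exact p.2.1.right_mem_trace
    · exact absurd (lt_val_of_mem_Wminus hW hC) (not_lt.2 hle)

/-- At or above the last critical level only the broken part counts; below it, only the orbit of the
end point, which is then not a rest point. -/
theorem eq_of_mem_hatTrace {p : P.Hat v} {y y' : M} (hy : y ∈ hatTrace v p)
    (hy' : y' ∈ hatTrace v p) (heq : P.h y = P.h y') : y = y' := by
  by_cases hle : p.1.1.val ≤ P.h y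
  · exact p.2.1.eq_of_mem_trace (mem_trace_iff.2 ⟨hy, hle⟩) (mem_trace_iff.2 ⟨hy', heq ▸ hle⟩) heq
  · have key : ∀ {z}, z ∈ hatTrace v p → P.h z = P.h y → ∃ t, P.phi t (hatI v p) = z := by
      intro z hz hzy
      rcases mem_hatTrace.1 hz with hz | ⟨t, -, ht⟩
      · exact absurd (hzy ▸ (p.2.1.mem_Icc_of_mem_trace hz).1) hle
      · exact ⟨t, ht⟩
    have hC : hatI v p ∉ P.critSet := fun hC => hle (by
      obtain ⟨t, ht⟩ := key hy rfl
      rw [← ht, P.phi_of_critical hC, Wminus_eq_of_critical (hatI_mem_Wminus p) hC]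
      exact le_rfl)
    exact P.isLyapunov.conn_unique hC (.inl (key hy rfl)) (.inl (key hy' heq.symm)) heq

theorem exists_mem_hatTrace {p : P.Hat v} {s : ℝ} (hs : s ∈ Icc (hatH v p) v.val) :
    ∃ y ∈ hatTrace v p, P.h y = s := by
  rcases le_or_gt p.1.1.val s with h1 | h1
  · obtain ⟨y, hy, hys⟩ := p.2.1.exists_mem_trace ⟨h1, hs.2⟩
    exact ⟨y, mem_hatTrace.2 (.inl hy), hys⟩
  · have hc := P.isLyapunov.cont
    obtain ⟨b, hb⟩ := ((((hc.tendsto _).comp (P.mem_Wminus.1 (hatI_mem_Wminus p))).eventually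
      (lt_mem_nhds h1)).and (eventually_le_atBot 0)).exists
    obtain ⟨t, ht, hts⟩ := intermediate_value_Icc' hb.2 (f := fun t => P.h (P.phi t (hatI v p)))
      (hc.comp (P.phi.continuous continuous_id continuous_const)).continuousOn
      ⟨by simpa [P.phi.map_zero_apply, hatH] using hs.1, hb.1.le⟩
    exact ⟨_, mem_hatTrace.2 (.inr ⟨t, ht.2, rfl⟩), hts⟩

/-- The bound `hle` is needed because the last orbit is cut off at the end point, unlike the earlier
ones. -/
theorem mem_hatTrace_of_conn {p : P.Hat v} {y z : M} (hy : y ∈ hatTrace v p)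
    (hyC : y ∉ P.critSet) (hz : FlowConn P.phi y z) (hle : hatH v p ≤ P.h z) :
    z ∈ hatTrace v p := by
  rcases mem_hatTrace.1 hy with hy | ⟨t, ht, rfl⟩
  · exact mem_hatTrace.2 (.inl (p.2.1.mem_trace_of_conn hy hyC hz))
  · have hxC : hatI v p ∉ P.critSet := fun hC => hyC (by rwa [P.phi_of_critical hC])
    rcases hz with ⟨s, rfl⟩ | hz | hz
    · rw [← P.phi.map_add] at hle ⊢
      refine mem_hatTrace.2 (.inr ⟨s + t, ?_, rfl⟩)
      refine (P.isLyapunov.strictAnti _ hxC).le_iff_ge.1 ?_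
      simpa [P.phi.map_zero_apply, hatH] using hle
    · have h1 := P.isLyapunov.lt_of_tendsto_atTop hyC hz (-t)
      rw [← P.phi.map_add, neg_add_cancel, P.phi.map_zero_apply] at h1
      exact absurd h1 (not_lt.2 hle)
    · rw [tendsto_nhds_unique hz (P.mem_Wminus.1 (phi_mem_Wminus (hatI_mem_Wminus p) t))]
      exact mem_hatTrace.2 (.inl p.2.1.right_mem_trace)

/-- Two points of a trajectory without critical level between them are on the same orbit, or one is
a limit of the orbit of the other. -/
theorem conn_of_mem_hatTrace {p : P.Hat v} {y z : M} (hy : y ∈ hatTrace v p)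
    (hz : z ∈ hatTrace v p) (hadj : LevelAdj P.h P.critSet y (P.h z)) : FlowConn P.phi y z := by
  obtain ⟨z', hc, hz'⟩ := P.isLyapunov.exists_conn hadj
  have h1 := mem_hatTrace_of_conn hy hadj.notMem hc (hz'.symm ▸ hatH_le_of_mem_hatTrace hz)
  rwa [← eq_of_mem_hatTrace h1 hz hz']

/-- An element of the completed unstable manifold is determined by its end point and its trace. -/
theorem hat_ext {p p' : P.Hat v} (hI : hatI v p = hatI v p')
    (hT : hatTrace v p = hatTrace v p') : p = p' := by
  obtain ⟨⟨w, hw⟩, β, ⟨x, hx⟩⟩ := p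
  obtain ⟨⟨w', hw'⟩, β', ⟨x', hx'⟩⟩ := p'
  obtain rfl : x = x' := hI
  obtain rfl : w = w' :=
    Subtype.ext (tendsto_nhds_unique (P.mem_Wminus.1 hx) (P.mem_Wminus.1 hx'))
  obtain rfl : β = β' := Broken.trace_injective (Set.ext fun y => by
    have h1 := mem_trace_iff (p := (⟨⟨w, hw⟩, β, ⟨x, hx⟩⟩ : P.Hat v)) (y := y)
    have h2 := mem_trace_iff (p := (⟨⟨w, hw'⟩, β', ⟨x, hx'⟩⟩ : P.Hat v)) (y := y)
    rw [hT] at h1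
    exact h1.trans h2.symm)
  rfl

/-! ### Assembling a broken trajectory from its points on all levels -/

theorem critSet_levels_finite (P : MorseSmalePair n M) (a b : ℝ) :
    (P.critValues ∩ Icc a b).Finite := by
  refine ((P.isLyapunov.finite a b).image P.h).subset ?_
  rintro _ ⟨⟨c, hc, rfl⟩, h⟩
  exact ⟨c, ⟨hc, h⟩, rfl⟩

theorem exists_least_critValue (P : MorseSmalePair n M) {s b : ℝ} (hb : b ∈ P.critValues)
    (hsb : s < b) :
    ∃ c ∈ P.critValues, s < c ∧ c ≤ b ∧ ∀ c' ∈ P.critValues, s < c' → c ≤ c' := by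
  have hfin : (P.critValues ∩ Ioc s b).Finite :=
    (P.critSet_levels_finite s b).subset (inter_subset_inter_right _ Ioc_subset_Icc_self)
  obtain ⟨c, hc, hmin⟩ := Set.exists_min_image _ id hfin ⟨b, hb, hsb, le_rfl⟩
  refine ⟨c, hc.1, hc.2.1, hc.2.2, fun c' hc' hs => ?_⟩
  rcases le_total c' b with h | h
  · exact hmin c' ⟨hc', hs, h⟩
  · exact hc.2.2.trans h

omit [T2Space M] in
theorem levelAdj_of_gap {y : M} {s c : ℝ} (hc : ∀ c' ∈ P.critValues, s < c' → c ≤ c')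
    (h1 : s < P.h y) (h2 : P.h y < c) {r : ℝ} (hr : r ∈ Icc s c) :
    LevelAdj P.h P.critSet y r := fun z hz => by
  have hzc : P.h z ∈ P.critValues := ⟨z, hz, rfl⟩
  refine ⟨fun h => ?_, fun h => ?_, fun h => ?_⟩
  · exact absurd (hc _ hzc (h ▸ h1)) (not_le.2 (h ▸ h2))
  · exact hr.2.trans (hc _ hzc (h1.trans h))
  · refine (not_lt.1 fun hs => ?_).trans hr.1
    exact absurd (hc _ hzc hs) (not_le.2 (h.trans h2))

omit [T2Space M] in
theorem Crit.val_mem (v : P.Crit) : v.val ∈ P.critValues := ⟨v.1, v.2, rfl⟩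

/-- A family of points on all levels below `v`, compatible with the flow between critical levels,
is a broken trajectory. -/
theorem exists_hat_of_conn {v : P.Crit} {a : ℝ} {g : ℝ → M}
    (hgh : ∀ s ∈ Icc a v.val, P.h (g s) = s) (hv : g v.val = v.1)
    (hg : ∀ s ∈ Icc a v.val, ∀ r ∈ Icc a v.val, LevelAdj P.h P.critSet (g r) s →
      FlowConn P.phi (g r) (g s)) (ha : a ≤ v.val) :
    ∃ p : P.Hat v, hatI v p = g a ∧ ∀ s ∈ Icc a v.val, g s ∈ hatTrace v p := by
  -- Induction on the number of critical values above `s`: the trajectory down to the next critical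
  -- level `c` is extended to the level `s`.
  suffices H : ∀ N : ℕ, ∀ s ∈ Icc a v.val, (P.critValues ∩ Ioc s v.val).ncard = N →
      ∃ p : P.Hat v, hatI v p = g s ∧ ∀ s' ∈ Icc s v.val, g s' ∈ hatTrace v p from
    H _ a ⟨le_rfl, ha⟩ rfl
  intro N
  induction N using Nat.strong_induction_on with
  | _ N ih =>
  intro s hs hN
  rcases hs.2.eq_or_lt with rfl | hlt
  · refine ⟨⟨⟨v, .inr rfl⟩, .const v, ⟨v.1, ?_⟩⟩, hv.symm, fun s' hs' => ?_⟩
    · rw [P.mem_Wminus]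
      simp_rw [P.phi_of_critical v.mem_critSet]
      exact tendsto_const_nhds
    · rw [le_antisymm hs'.2 hs'.1, hv]
      exact left_mem_hatTrace _
  obtain ⟨c, hcC, hsc, hcv, hmin⟩ := P.exists_least_critValue v.val_mem hlt
  have hca : c ∈ Icc a v.val := ⟨hs.1.trans hsc.le, hcv⟩
  have hfin : (P.critValues ∩ Ioc s v.val).Finite :=
    (P.critSet_levels_finite s v.val).subset (inter_subset_inter_right _ Ioc_subset_Icc_self)
  obtain ⟨p, hpI, hpT⟩ := ih _ (by
    rw [← hN]
    refine ncard_lt_ncard ⟨inter_subset_inter_right _ (Ioc_subset_Ioc_left hsc.le), fun hsub => ?_⟩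
      hfin
    exact lt_irrefl c (hsub ⟨hcC, hsc, hcv⟩).2.1) c hca rfl
  -- A regular level inside the gap: `g r` is linked by the flow to both `g c` and `g s`, even when
  -- these are critical.
  obtain ⟨r, hr1, hr2⟩ := exists_between hsc
  have hra : r ∈ Icc a v.val := ⟨hs.1.trans hr1.le, hr2.le.trans hcv⟩
  have hgr := hgh r hra
  have hadj : ∀ s' ∈ Icc s c, LevelAdj P.h P.critSet (g r) s' := fun s' hs' =>
    levelAdj_of_gap hmin (by rwa [hgr]) (by rwa [hgr]) hs'
  have hgC : g r ∉ P.critSet := (hadj s ⟨le_rfl, hsc.le⟩).notMem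
  have hcc := hg c hca r hra (hadj c ⟨hsc.le, le_rfl⟩)
  have hcs := hg s hs r hra (hadj s ⟨le_rfl, hsc.le⟩)
  -- If `g c` lies on the orbit of `g r`, the unstable manifold is inherited by flow invariance. If
  -- `g c` is its limit at `-∞`, then `g c` is the last critical point of `p`.
  have hgrW : g r ∈ P.Wminus p.1.1 := by
    have hW := hatI_mem_Wminus p
    rw [hpI] at hW
    rcases hcc with ⟨t, ht⟩ | h1 | h1
    · rw [← ht] at hW
      have := phi_mem_Wminus hW (-t)
      rwa [← P.phi.map_add, neg_add_cancel, P.phi.map_zero_apply] at this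
    · have := P.isLyapunov.lt_of_tendsto_atTop hgC h1 0
      rw [P.phi.map_zero_apply, hgh c hca, hgr] at this
      exact absurd this (not_lt.2 hr2.le)
    · have hC := P.isLyapunov.mem_of_tendsto_atBot h1
      rw [Wminus_eq_of_critical hW hC] at h1
      exact P.mem_Wminus.2 h1
  obtain ⟨p', hp'I, hp'T, hp'r⟩ : ∃ p' : P.Hat v, hatI v p' = g s ∧
      p.2.1.trace ⊆ hatTrace v p' ∧ g r ∈ hatTrace v p' := by
    -- If `g s` is critical, the orbit of `g r` is a further complete step, admissible because it
    -- lowers the index. Otherwise only the end point moves along the unstable manifold.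
    by_cases hsC : g s ∈ P.critSet
    · rcases hcs with ⟨t, ht⟩ | h1 | h1
      · exact absurd (ht ▸ hsC) (P.isLyapunov.map_notMem hgC t)
      · let u : P.Crit := ⟨g s, hsC⟩
        have hu : g r ∈ P.Wplus u := P.mem_Wplus.2 h1
        have hb := P.below_of_mem hgrW hu hgC
        let γ : P.Traj p.1.1 u := ⟨P.orbit (g r), g r, ⟨hgrW, hu⟩, rfl⟩
        have hsub := p.2.1.subset_trace_snoc hb γ
        refine ⟨⟨⟨u, (p.2.1.snoc hb γ).below_or_eq⟩, p.2.1.snoc hb γ, ⟨g s, ?_⟩⟩, rfl,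
          fun y hy => mem_hatTrace.2 (.inl (hsub.1 hy)),
          mem_hatTrace.2 (.inl (hsub.2 (mem_orbit.2 ⟨0, P.phi.map_zero_apply _⟩)))⟩
        rw [P.mem_Wminus]
        simp_rw [P.phi_of_critical hsC]
        exact tendsto_const_nhds
      · have := P.isLyapunov.lt_of_tendsto_atBot hgC h1 0
        rw [P.phi.map_zero_apply, hgh s hs, hgr] at this
        exact absurd this (not_lt.2 hr1.le)
    · obtain ⟨t, ht⟩ := P.isLyapunov.orbit_of_conn hcs hsC
      have ht0 : 0 ≤ t := by
        refine (P.isLyapunov.strictAnti _ hgC).le_iff_ge.1 ?_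
        simp only [P.phi.map_zero_apply, ht, hgr, hgh s hs]
        exact hr1.le
      refine ⟨⟨p.1, p.2.1, ⟨g s, ht ▸ phi_mem_Wminus hgrW t⟩⟩, rfl,
        fun y hy => mem_hatTrace.2 (.inl hy), mem_hatTrace.2 (.inr ⟨-t, by linarith, ?_⟩)⟩
      change P.phi (-t) (g s) = g r
      rw [← ht, ← P.phi.map_add, neg_add_cancel, P.phi.map_zero_apply]
  have hlow : hatH v p' = s := by rw [hatH, Function.comp_apply, hp'I, hgh s hs]
  have hbelow : ∀ s' ∈ Icc s c, g s' ∈ hatTrace v p' := fun s' hs' => by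
    have hs'a : s' ∈ Icc a v.val := ⟨hs.1.trans hs'.1, hs'.2.trans hcv⟩
    refine mem_hatTrace_of_conn hp'r hgC (hg s' hs'a r hra (hadj s' hs')) ?_
    rw [hlow, hgh s' hs'a]
    exact hs'.1
  refine ⟨p', hp'I, fun s' hs' => ?_⟩
  rcases le_total s' c with h1 | h1
  · exact hbelow s' ⟨hs'.1, h1⟩
  -- Above `c`, a point is in the broken part of `p` or on the orbit ending at `g c`. The new trace
  -- contains `g c` and therefore that arc as well.
  · rcases mem_hatTrace.1 (hpT s' ⟨h1, hs'.2⟩) with h2 | ⟨t, ht, h2⟩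
    · exact hp'T h2
    · rw [hpI] at h2
      have hgc := hbelow c ⟨hsc.le, le_rfl⟩
      by_cases hC : g c ∈ P.critSet
      · rw [← h2, P.phi_of_critical hC]
        exact hgc
      · refine mem_hatTrace_of_conn hgc hC (.inl ⟨t, h2⟩) ?_
        rw [hlow, hgh s' ⟨hs.1.trans hs'.1, hs'.2⟩]
        exact hs'.1

end MorseSmalePair

/-- A level that is adjacent to a point stays so under perturbation, as long as it does not cross
a critical level. -/
theorem IsLyapunov.eventually_levelAdj {M : Type*} [TopologicalSpace M] {φ : Flow ℝ M} {h : M → ℝ}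
    {C : Set M} (L : IsLyapunov φ h C) {ι : Type*} {l : Filter ι} {x : ι → M} {σ : ι → ℝ}
    {x₀ : M} {s₀ : ℝ} (hx : Tendsto (fun i => h (x i)) l (𝓝 (h x₀))) (hσ : Tendsto σ l (𝓝 s₀))
    (hadj : LevelAdj h C x₀ s₀) (h1 : ∀ᶠ i in l, h x₀ < s₀ → σ i ≤ s₀)
    (h2 : ∀ᶠ i in l, s₀ < h x₀ → s₀ ≤ σ i) : ∀ᶠ i in l, LevelAdj h C (x i) (σ i) := by
  -- Only the finitely many critical points with levels in this window need an argument; levels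
  -- outside it eventually lie on the same side of both `h (x i)` and `σ i`.
  set a := min (h x₀) s₀ - 1
  set b := max (h x₀) s₀ + 1
  have ha : a < h x₀ ∧ a < s₀ :=
    ⟨(sub_one_lt _).trans_le (min_le_left _ _), (sub_one_lt _).trans_le (min_le_right _ _)⟩
  have hb : h x₀ < b ∧ s₀ < b :=
    ⟨(le_max_left _ _).trans_lt (lt_add_one _), (le_max_right _ _).trans_lt (lt_add_one _)⟩
  have hF : ∀ᶠ i in l, ∀ c ∈ C ∩ h ⁻¹' Icc a b,
      h (x i) ≠ h c ∧ (h (x i) < h c → σ i ≤ h c) ∧ (h c < h (x i) → h c ≤ σ i) := by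
    rw [(L.finite a b).eventually_all]
    rintro c ⟨hc, -⟩
    obtain ⟨hne, hlt, hgt⟩ := hadj c hc
    rcases lt_or_gt_of_ne hne with hc | hc
    · have h3 : ∀ᶠ i in l, σ i ≤ h c := by
        rcases (hlt hc).lt_or_eq with h4 | h4
        · exact (hσ.eventually (gt_mem_nhds h4)).mono fun i hi => hi.le
        · exact h1.mono fun i hi => (hi (h4 ▸ hc)).trans_eq h4
      filter_upwards [h3, hx.eventually (gt_mem_nhds hc)] with i h5 h6
      exact ⟨h6.ne, fun _ => h5, fun h => absurd h h6.not_gt⟩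
    · have h3 : ∀ᶠ i in l, h c ≤ σ i := by
        rcases (hgt hc).lt_or_eq with h4 | h4
        · exact (hσ.eventually (lt_mem_nhds h4)).mono fun i hi => hi.le
        · exact h2.mono fun i hi => h4.trans_le (hi (h4 ▸ hc))
      filter_upwards [h3, hx.eventually (lt_mem_nhds hc)] with i h5 h6
      exact ⟨h6.ne', fun h => absurd h h6.not_gt, fun _ => h5⟩
  filter_upwards [hF, hx.eventually (lt_mem_nhds ha.1), hx.eventually (gt_mem_nhds hb.1),
    hσ.eventually (lt_mem_nhds ha.2), hσ.eventually (gt_mem_nhds hb.2)] with i hi i1 i2 i3 i4 c hc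
  by_cases hcm : h c ∈ Icc a b
  · exact hi c ⟨hc, hcm⟩
  · rw [mem_Icc, not_and_or, not_le, not_le] at hcm
    rcases hcm with hcm | hcm
    · exact ⟨(hcm.trans i1).ne', fun h => absurd h (hcm.trans i1).not_gt,
        fun _ => (hcm.trans i3).le⟩
    · exact ⟨(i2.trans hcm).ne, fun _ => (i4.trans hcm).le,
        fun h => absurd h (i2.trans hcm).not_gt⟩

/-! ### The topology of pointwise convergence of trajectories -/

namespace MorseSmalePair

universe u

variable {n : ℕ} {M : Type u} [TopologicalSpace M] [ChartedSpace (Rn n) M]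
  [IsManifold (𝓡 n) ∞ M] {P : MorseSmalePair n M} {v w : P.Crit}

/-- The point of the trajectory of `p` on the level `s`, or the end point of `p` if it is above
this level. -/
def pathPoint (v : P.Crit) (p : P.Hat v) (s : ℝ) : M :=
  pointAt v (hatTrace v p) (max s (hatH v p))

/-- An element of the completed unstable manifold as an end point and a path. -/
def pathMap (v : P.Crit) (p : P.Hat v) : M × (ℝ → M) := (hatI v p, pathPoint v p)

/-- The topology of pointwise convergence of the trajectories. -/
@[reducible] def pathTopology (v : P.Crit) : TopologicalSpace (P.Hat v) :=
  TopologicalSpace.induced (pathMap v) inferInstance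

theorem pointAt_spec {S : Set M} {s : ℝ} (H : ∃ y ∈ S, P.h y = s) :
    pointAt v S s ∈ S ∧ P.h (pointAt v S s) = s := by
  rw [pointAt, dif_pos H]
  exact H.choose_spec

variable [T2Space M]

theorem pointAt_hatTrace {p : P.Hat v} {s : ℝ} (hs : s ∈ Icc (hatH v p) v.val) :
    pointAt v (hatTrace v p) s ∈ hatTrace v p ∧ P.h (pointAt v (hatTrace v p) s) = s :=
  pointAt_spec (exists_mem_hatTrace hs)

theorem pointAt_eq_of_mem {p : P.Hat v} {y : M} (hy : y ∈ hatTrace v p) {s : ℝ}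
    (hs : P.h y = s) : pointAt v (hatTrace v p) s = y := by
  subst hs
  obtain ⟨h1, h2⟩ := pointAt_spec (v := v) (P := P) ⟨y, hy, rfl⟩
  exact eq_of_mem_hatTrace h1 hy h2

theorem pointAt_eq_top {p : P.Hat v} {s : ℝ} (hs : v.val ≤ s) :
    pointAt v (hatTrace v p) s = v.1 := by
  rcases hs.eq_or_lt with h | h
  · exact pointAt_eq_of_mem (left_mem_hatTrace p) h
  · rw [pointAt, dif_neg]
    rintro ⟨y, hy, rfl⟩
    exact absurd (le_val_of_mem_hatTrace hy) (not_le.2 h)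

omit [T2Space M] in
theorem pathPoint_of_le {p : P.Hat v} {s : ℝ} (hs : hatH v p ≤ s) :
    pathPoint v p s = pointAt v (hatTrace v p) s := by
  rw [pathPoint, max_eq_left hs]

theorem pathPoint_of_ge {p : P.Hat v} {s : ℝ} (hs : s ≤ hatH v p) :
    pathPoint v p s = hatI v p := by
  rw [pathPoint, max_eq_right hs]
  exact pointAt_eq_of_mem (hatI_mem_hatTrace p) rfl

theorem pathPoint_eq_top {p : P.Hat v} {s : ℝ} (hs : v.val ≤ s) : pathPoint v p s = v.1 :=
  pointAt_eq_top (hs.trans (le_max_left _ _))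

theorem pathPoint_spec {p : P.Hat v} {s : ℝ} (hs : s ≤ v.val) :
    pathPoint v p s ∈ hatTrace v p ∧ P.h (pathPoint v p s) = max s (hatH v p) :=
  pointAt_hatTrace ⟨le_max_right _ _, max_le hs (hatH_le_val p)⟩

/-- The path passes through every point of the trace at its own level, so it recovers the trace. -/
theorem pathMap_injective : Function.Injective (pathMap (P := P) v) := fun p p' heq => by
  have hI : hatI v p = hatI v p' := congrArg Prod.fst heq
  have hP : pathPoint v p = pathPoint v p' := congrArg Prod.snd heq
  have key : ∀ q q' : P.Hat v, hatI v q = hatI v q' → pathPoint v q = pathPoint v q' →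
      hatTrace v q ⊆ hatTrace v q' := fun q q' h1 h2 y hy => by
    have h3 : pathPoint v q (P.h y) = y := by
      rw [pathPoint_of_le (hatH_le_of_mem_hatTrace hy)]
      exact pointAt_eq_of_mem hy rfl
    rw [← h3, h2]
    exact (pathPoint_spec (le_val_of_mem_hatTrace hy)).1
  exact hat_ext hI (Subset.antisymm (key p p' hI hP) (key p' p hI.symm hP.symm))

theorem t2Space_pathTopology (v : P.Crit) : @T2Space (P.Hat v) (pathTopology v) :=
  letI := pathTopology v
  (Topology.IsEmbedding.mk ⟨rfl⟩ pathMap_injective).t2Space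

/-- The point of a trajectory on a level `s` varies continuously with the trajectory if a point of
an adjacent level does. -/
theorem tendsto_pointAt {ι : Type*} {l : Filter ι} {q : ι → P.Hat v} {q₀ : P.Hat v} {x : ι → M}
    {x₀ : M} (hx : Tendsto x l (𝓝 x₀)) (hxm : ∀ᶠ i in l, x i ∈ hatTrace v (q i))
    (hx₀ : x₀ ∈ hatTrace v q₀) {s : ℝ} (hs : ∀ᶠ i in l, s ∈ Icc (hatH v (q i)) v.val)
    (hs₀ : s ∈ Icc (hatH v q₀) v.val)
    (hadj : ∀ᶠ i in l, LevelAdj P.h P.critSet (x i) s) (hadj₀ : LevelAdj P.h P.critSet x₀ s) :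
    Tendsto (fun i => pointAt v (hatTrace v (q i)) s) l
      (𝓝 (pointAt v (hatTrace v q₀) s)) := by
  obtain ⟨h1, h2⟩ := pointAt_hatTrace hs₀
  have hlev : ∀ᶠ i in l, P.h (pointAt v (hatTrace v (q i)) s) = s :=
    hs.mono fun i hi => (pointAt_hatTrace hi).2
  refine P.isLyapunov.tendsto_of_conn hx ?_ ?_ ?_ hadj₀.notMem
    (conn_of_mem_hatTrace hx₀ h1 (h2.symm ▸ hadj₀))
  · filter_upwards [hxm, hs, hadj] with i h3 h4 h5
    obtain ⟨h6, h7⟩ := pointAt_hatTrace h4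
    exact conn_of_mem_hatTrace h3 h6 (h7.symm ▸ h5)
  · filter_upwards [hadj, hlev] with i h3 h4
    rwa [h4]
  · rw [h2]
    exact tendsto_const_nhds.congr' (hlev.mono fun i hi => hi.symm)

theorem exists_greatest_critValue (P : MorseSmalePair n M) {s b : ℝ} (hb : b ∈ P.critValues)
    (hsb : b ≤ s) :
    ∃ c ∈ P.critValues, c ≤ s ∧ b ≤ c ∧ ∀ c' ∈ P.critValues, c < c' → s < c' := by
  obtain ⟨c, hc, hmax⟩ := Set.exists_max_image _ id (P.critSet_levels_finite b s)
    ⟨b, hb, le_rfl, hsb⟩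
  refine ⟨c, hc.1, hc.2.2, hc.2.1, fun c' hc' hs => ?_⟩
  by_contra! h
  exact absurd (hmax c' ⟨hc', hc.2.1.trans hs.le, h⟩) (not_le.2 hs)

/-- If the points on the levels `c - ε_c` above `b` vary continuously, so does the point on every
level `s ≥ b`. -/
theorem tendsto_pointAt_of_levels {ε : ℝ → ℝ} (hε : P.AdmissibleEps ε) {ι : Type*} {l : Filter ι}
    {q : ι → P.Hat v} {q₀ : P.Hat v} {b s : ℝ} (hb : b ∈ P.critValues) (hbs : b ≤ s)
    (hq : ∀ c ∈ P.critValues, b < c → c ≤ v.val →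
      Tendsto (fun i => pointAt v (hatTrace v (q i)) (c - ε c)) l
        (𝓝 (pointAt v (hatTrace v q₀) (c - ε c))))
    (hle : ∀ c ∈ P.critValues, b < c → ∀ᶠ i in l, hatH v (q i) ≤ c - ε c)
    (hle₀ : ∀ c ∈ P.critValues, b < c → hatH v q₀ ≤ c - ε c)
    (hs : ∀ᶠ i in l, hatH v (q i) ≤ s) (hs₀ : hatH v q₀ ≤ s) :
    Tendsto (fun i => pointAt v (hatTrace v (q i)) s) l
      (𝓝 (pointAt v (hatTrace v q₀) s)) := by
  rcases le_or_gt v.val s with hvs | hvs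
  · simp only [pointAt_eq_top hvs]
    exact tendsto_const_nhds
  -- The consecutive critical values `a ≤ s < c` enclose the regular level `c - ε c`, which is
  -- therefore adjacent to `s`, also when `s = a`.
  obtain ⟨c, hc, hsc, hcv, hmin⟩ := P.exists_least_critValue v.val_mem hvs
  obtain ⟨a, ha, has, hba, hmax⟩ := P.exists_greatest_critValue hb hbs
  have hbc : b < c := hbs.trans_lt hsc
  obtain ⟨hε0, hε1⟩ := hε c hc
  have hac := hε1 a ha (has.trans_lt hsc)
  have hmin' : ∀ c' ∈ P.critValues, a < c' → c ≤ c' := fun c' hc' h => hmin c' hc' (hmax c' hc' h)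
  have hcε : c - ε c ≤ v.val := by linarith
  have hadj : ∀ p : P.Hat v, hatH v p ≤ c - ε c →
      LevelAdj P.h P.critSet (pointAt v (hatTrace v p) (c - ε c)) s := fun p hp => by
    have h1 := (pointAt_hatTrace (v := v) ⟨hp, hcε⟩).2
    exact levelAdj_of_gap hmin' (by rw [h1]; linarith) (by rw [h1]; linarith) ⟨has, hsc.le⟩
  exact tendsto_pointAt (hq c hc hbc hcv)
    ((hle c hc hbc).mono fun i hi => (pointAt_hatTrace ⟨hi, hcε⟩).1)
    (pointAt_hatTrace ⟨hle₀ c hc hbc, hcε⟩).1 (hs.mono fun i hi => ⟨hi, hvs.le⟩) ⟨hs₀, hvs.le⟩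
    ((hle c hc hbc).mono fun i hi => hadj _ hi) (hadj _ (hle₀ c hc hbc))

/-! ### Comparison with the topologies defined by `ε` and `δ` -/

section Pieces

variable {ε δ : ℝ → ℝ}

-- This makes the value of `pointAt` in `hatJ` a genuine point of the trajectory. For the next
-- critical value it is the condition `ε ≤ δ`; for higher ones the gap condition on `ε` suffices.
omit [T2Space M] in
theorem hatH_le_of_mem_hatPiece (hA : P.Admissible ε δ) {c c' : ℝ} (hc : c ∈ P.critValues)
    (hc' : c' ∈ P.critValues) (hlt : c < c') {p : P.Hat v} (hp : p ∈ hatPiece δ v c) :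
    hatH v p ≤ c' - ε c' := by
  obtain ⟨hε, hδ, hεδ⟩ := hA
  by_cases hbet : ∃ c'' ∈ P.critValues, c < c'' ∧ c'' < c'
  · obtain ⟨c'', h1, h2, h3⟩ := hbet
    have h4 := (hp c'' h1).2 h2
    have h5 := (hε c' hc').2 c'' h1 h3
    have h6 := (hε c' hc').1
    have h7 := (hδ c hc).1
    linarith
  · push Not at hbet
    have h1 := hεδ c' hc' c hc hlt fun c'' h2 h3 => absurd h3.2 (not_lt.2 (hbet c'' h2 h3.1))
    have h2 := (hp c' hc').2 hlt
    linarith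

/-- Levels at or above `c` are controlled by the recorded points on the levels `c' - ε c'`, and
levels below `c` by the end point, which is also recorded. -/
theorem pieceTopology_eq (hA : P.Admissible ε δ) {c : ℝ} (hc : c ∈ P.critValues) :
    pieceTopology ε δ v c = TopologicalSpace.induced Subtype.val (pathTopology v) := by
  refine le_antisymm ?_ ?_
  · let := pieceTopology ε δ v c
    rw [pathTopology, induced_compose, ← continuous_iff_le_induced]
    have hJ : Continuous (hatJ ε δ v c) := continuous_induced_dom
    have hI : Continuous fun p : hatPiece δ v c => hatI v p.1 := continuous_snd.comp hJ
    have hH : Continuous fun p : hatPiece δ v c => hatH v p.1 := P.isLyapunov.cont.comp hI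
    refine Continuous.prodMk hI (continuous_pi fun s => ?_)
    have hA1 : IsClosed {p : hatPiece δ v c | s ≤ hatH v p.1} := isClosed_le continuous_const hH
    have hB1 : IsClosed {p : hatPiece δ v c | hatH v p.1 ≤ s} := isClosed_le hH continuous_const
    rw [← continuousOn_univ, ← show {p : hatPiece δ v c | s ≤ hatH v p.1} ∪
      {p : hatPiece δ v c | hatH v p.1 ≤ s} = univ from
      eq_univ_of_forall fun p => le_total s (hatH v p.1)]
    refine ContinuousOn.union_of_isClosed ?_ ?_ hA1 hB1
    · exact hI.continuousOn.congr fun p hp => pathPoint_of_ge hp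
    · refine ContinuousOn.congr (f := fun p : hatPiece δ v c => pointAt v (hatTrace v p.1) s)
        (fun p₀ hp₀ => ?_) fun p hp => pathPoint_of_le hp
      have hev : ∀ᶠ p in 𝓝[{p : hatPiece δ v c | hatH v p.1 ≤ s}] p₀, hatH v p.1 ≤ s :=
        eventually_mem_nhdsWithin
      rcases le_or_gt c s with hcs | hcs
      · refine tendsto_pointAt_of_levels hA.1 hc hcs (fun c' hc' h1 h2 => ?_)
          (fun c' hc' h1 => Eventually.of_forall fun p => hatH_le_of_mem_hatPiece hA hc hc' h1 p.2)
          (fun c' hc' h1 => hatH_le_of_mem_hatPiece hA hc hc' h1 p₀.2) hev hp₀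
        exact (((continuous_apply ⟨c', hc', h1, h2⟩).comp (continuous_fst.comp hJ)).tendsto
          p₀).mono_left nhdsWithin_le_nhds
      -- The end point lies at most at `s < c`, and by definition of the piece strictly above every
      -- critical level below `c`. So the level `s` is adjacent to the end point itself.
      · have hadj : ∀ p : hatPiece δ v c, hatH v p.1 ≤ s →
            LevelAdj P.h P.critSet (hatI v p.1) s := fun p hp z hz => by
          have hp' : P.h (hatI v p.1) ≤ s := hp
          have hz' : P.h z ∈ P.critValues := ⟨z, hz, rfl⟩
          rcases lt_or_ge (P.h z) c with h1 | h1
          · have h2 : P.h z + δ c ≤ P.h (hatI v p.1) := (p.2 _ hz').1 h1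
            have h3 := (hA.2.1 c hc).1
            exact ⟨by linarith, fun h => by linarith, fun h => by linarith⟩
          · exact ⟨by linarith, fun h => by linarith, fun h => by linarith⟩
        rcases le_or_gt s v.val with hsv | hsv
        · exact tendsto_pointAt (hI.tendsto p₀ |>.mono_left nhdsWithin_le_nhds)
            (Eventually.of_forall fun p => hatI_mem_hatTrace p.1) (hatI_mem_hatTrace p₀.1)
            (hev.mono fun p hp => ⟨hp, hsv⟩) ⟨hp₀, hsv⟩ (hev.mono hadj) (hadj p₀ hp₀)
        · simp only [ContinuousWithinAt, pointAt_eq_top hsv.le]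
          exact tendsto_const_nhds
  · let := pathTopology v
    rw [pieceTopology, ← continuous_iff_le_induced]
    have hE : Continuous (pathMap (P := P) v) := continuous_induced_dom
    refine Continuous.prodMk (continuous_pi fun c' => ?_)
      ((continuous_fst.comp hE).comp continuous_subtype_val)
    have h1 : Continuous fun p : hatPiece δ v c => pathPoint v p.1 (c'.1 - ε c'.1) :=
      ((continuous_apply _).comp (continuous_snd.comp hE)).comp continuous_subtype_val
    refine h1.congr fun p => ?_
    exact pathPoint_of_le (hatH_le_of_mem_hatPiece hA hc c'.2.1 c'.2.2.1 p.2)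

/-- Every point has a whole neighbourhood of levels in some piece. -/
theorem exists_hatPiece (hδ : P.AdmissibleDelta δ) (p : P.Hat v) :
    ∃ c ∈ P.critValues, c ≤ v.val ∧ ∃ η > 0, ∀ p' : P.Hat v, |hatH v p' - hatH v p| < η →
      p' ∈ hatPiece δ v c := by
  have hsep : ∀ c ∈ P.critValues, ∀ c' ∈ P.critValues,
      (c' < c → c' + 2 * δ c < c) ∧ (c < c' → c + 2 * δ c < c') := fun c hc c' hc' => by
    refine ⟨fun h => ?_, fun h => ?_⟩
    · have := (hδ c hc).2 c' hc' h.ne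
      rw [abs_of_pos (sub_pos.2 h)] at this
      linarith
    · have := (hδ c hc).2 c' hc' h.ne'
      rw [abs_of_neg (sub_neg.2 h)] at this
      linarith
  rcases (hatH_le_val p).eq_or_lt with htop | hlt
  · refine ⟨v.val, v.val_mem, le_rfl, δ v.val, (hδ _ v.val_mem).1, fun p' hp' c' hc' => ?_⟩
    obtain ⟨h1, h2⟩ := abs_lt.1 hp'
    obtain ⟨h3, h4⟩ := hsep _ v.val_mem c' hc'
    exact ⟨fun h => by linarith [h3 h], fun h => by linarith [h4 h]⟩
  obtain ⟨b, hb, hpb, hbv, hmin⟩ := P.exists_least_critValue v.val_mem hlt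
  have hδb := (hδ b hb).1
  by_cases hex : ∃ a ∈ P.critValues, a ≤ hatH v p
  · obtain ⟨a', ha', hap'⟩ := hex
    obtain ⟨a, ha, hap, -, hmax⟩ := P.exists_greatest_critValue ha' hap'
    have hδa := (hδ a ha).1
    have hab := hap.trans_lt hpb
    have h3 := (hsep a ha b hb).2 hab
    have h4 := (hsep b hb a ha).1 hab
    -- Each `δ` is less than half of the gap, so `a + δ b < b - δ a`: the two pieces overlap and a
    -- neighbourhood of levels fits in one of them.
    rcases lt_or_ge (hatH v p) (b - δ a) with h5 | h5
    · refine ⟨a, ha, hab.le.trans hbv, min (δ a) (b - δ a - hatH v p), lt_min hδa (by linarith),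
        fun p' hp' c' hc' => ?_⟩
      obtain ⟨h1, h2⟩ := abs_lt.1 hp'
      have m1 := min_le_left (δ a) (b - δ a - hatH v p)
      have m2 := min_le_right (δ a) (b - δ a - hatH v p)
      refine ⟨fun h => by linarith [(hsep a ha c' hc').1 h], fun h => ?_⟩
      linarith [hmin c' hc' (hmax c' hc' h)]
    · refine ⟨b, hb, hbv, min (δ b) (hatH v p - (a + δ b)), lt_min hδb (by linarith),
        fun p' hp' c' hc' => ?_⟩
      obtain ⟨h1, h2⟩ := abs_lt.1 hp'
      have m1 := min_le_left (δ b) (hatH v p - (a + δ b))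
      have m2 := min_le_right (δ b) (hatH v p - (a + δ b))
      refine ⟨fun h => ?_, fun h => by linarith [(hsep b hb c' hc').2 h]⟩
      have : c' ≤ a := not_lt.1 fun h6 => absurd (hmin c' hc' (hmax c' hc' h6)) (not_le.2 h)
      linarith
  · push Not at hex
    refine ⟨b, hb, hbv, δ b, hδb, fun p' hp' c' hc' => ?_⟩
    obtain ⟨h1, h2⟩ := abs_lt.1 hp'
    refine ⟨fun h => absurd (hmin c' hc' (hex c' hc')) (not_le.2 h),
      fun h => by linarith [(hsep b hb c' hc').2 h]⟩

omit [T2Space M] in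
theorem continuous_hatI (v : P.Crit) :
    @Continuous (P.Hat v) M (pathTopology v) _ (hatI v) :=
  letI := pathTopology v
  continuous_fst.comp (continuous_induced_dom (f := pathMap (P := P) v))

/-- Since every point has a neighbourhood, in the pointwise topology, contained in one piece,
openness can be tested on the pieces. -/
theorem hatTopology_eq (hA : P.Admissible ε δ) : hatTopology ε δ v = pathTopology v := by
  refine le_antisymm (iSup_le fun c => ?_) ?_
  · rw [pieceTopology_eq hA c.2.1]
    exact coinduced_le_iff_le_induced.2 le_rfl
  · let := pathTopology v
    intro U hU
    change IsOpen U
    rw [isOpen_iff_mem_nhds]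
    intro p hp
    obtain ⟨c, hc, hcv, η, hη, hpiece⟩ := exists_hatPiece hA.2.1 p
    have h1 := isOpen_iSup_iff.1 hU ⟨c, hc, hcv⟩
    rw [isOpen_coinduced, pieceTopology_eq hA hc, isOpen_induced_iff] at h1
    obtain ⟨V, hV, hVU⟩ := h1
    have hH : Continuous (hatH (P := P) v) := P.isLyapunov.cont.comp (continuous_hatI v)
    have h2 : ∀ᶠ p' in 𝓝 p, p' ∈ hatPiece δ v c := by
      filter_upwards [hH.continuousAt.eventually (Metric.ball_mem_nhds (hatH v p) hη)] with p' hp'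
      exact hpiece p' (by rwa [← Real.dist_eq])
    have hpV : p ∈ V := by
      have : (⟨p, h2.self_of_nhds⟩ : hatPiece δ v c) ∈ Subtype.val ⁻¹' U := hp
      rw [← hVU] at this
      exact this
    filter_upwards [h2, hV.mem_nhds hpV] with p' h3 h4
    have : (⟨p', h3⟩ : hatPiece δ v c) ∈ Subtype.val ⁻¹' V := h4
    rw [hVU] at this
    exact this

end Pieces

/-! ### Spaces of broken trajectories as fibres of `hatI` -/

/-- The broken trajectories from `v` to `w` as elements of the completed unstable manifold. -/
def Broken.toHat (γ : P.Broken v w) : P.Hat v :=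
  ⟨⟨w, γ.below_or_eq⟩, γ, ⟨w.1, P.mem_Wminus.2 (by
    simp_rw [P.phi_of_critical w.mem_critSet]
    exact tendsto_const_nhds)⟩⟩

theorem Broken.hatTrace_toHat (γ : P.Broken v w) : hatTrace v γ.toHat = γ.trace := by
  ext y
  rw [mem_hatTrace]
  refine ⟨?_, .inl⟩
  rintro (hy | ⟨t, -, rfl⟩)
  · exact hy
  · change P.phi t w.1 ∈ _
    rw [P.phi_of_critical w.mem_critSet]
    exact γ.right_mem_trace

theorem Broken.toHat_injective : Function.Injective (Broken.toHat (P := P) (v := v) (w := w)) :=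
  fun γ γ' h => Broken.trace_injective (by rw [← γ.hatTrace_toHat, h, γ'.hatTrace_toHat])

/-- The only unstable manifold containing the critical point `w` is its own, since `w` is at rest.
-/
theorem range_toHat (v w : P.Crit) :
    range (Broken.toHat (P := P) (v := v) (w := w)) = hatI v ⁻¹' {w.1} := by
  ext p
  constructor
  · rintro ⟨γ, rfl⟩
    exact rfl
  · intro hp
    obtain ⟨⟨w', hw'⟩, γ, ⟨x, hx⟩⟩ := p
    obtain rfl : x = w.1 := hp
    obtain rfl : w = w' := Subtype.ext (Wminus_eq_of_critical hx w.2)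
    exact ⟨γ, rfl⟩

/-- All end points are `w`, so the points on the levels `c - ε c` above `w` determine the
convergence of the whole path. -/
theorem brokenTopology_eq {ε : ℝ → ℝ} (hε : P.AdmissibleEps ε) (v w : P.Crit) :
    brokenTopology ε v w = TopologicalSpace.induced Broken.toHat (pathTopology v) := by
  have hlev : ∀ c ∈ P.critValues, w.val < c → w.val ≤ c - ε c := fun c hc h => by
    have h1 := (hε c hc).2 _ w.val_mem h
    have h2 := (hε c hc).1
    linarith
  refine le_antisymm ?_ ?_
  · let := brokenTopology ε v w
    rw [pathTopology, induced_compose, ← continuous_iff_le_induced]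
    have hJ : Continuous (J (P := P) ε v w) := continuous_induced_dom
    refine Continuous.prodMk (f := fun γ : P.Broken v w => hatI v γ.toHat)
      (continuous_const (y := w.1)) (continuous_pi fun s => ?_)
    change Continuous fun γ : P.Broken v w => pathPoint v γ.toHat s
    rcases le_total s w.val with hs | hs
    · exact Continuous.congr (continuous_const (y := w.1))
        fun γ => (pathPoint_of_ge (p := γ.toHat) hs).symm
    refine Continuous.congr ?_ fun γ : P.Broken v w => (pathPoint_of_le (p := γ.toHat) hs).symm
    rw [continuous_iff_continuousAt]
    intro γ₀
    refine tendsto_pointAt_of_levels hε w.val_mem hs (fun c hc h1 h2 => ?_)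
      (fun c hc h => Eventually.of_forall fun γ => hlev c hc h) (fun c hc h => hlev c hc h)
      (Eventually.of_forall fun γ => hs) hs
    simp only [Broken.hatTrace_toHat]
    exact ((continuous_apply (⟨c, hc, h1, h2⟩ :
      {c : ℝ // c ∈ P.critValues ∧ w.val < c ∧ c ≤ v.val})).comp hJ).tendsto γ₀
  · let := pathTopology v
    let : TopologicalSpace (P.Broken v w) := .induced Broken.toHat (pathTopology v)
    rw [brokenTopology, ← continuous_iff_le_induced]
    have hE : Continuous (pathMap (P := P) v) := continuous_induced_dom
    have hι : Continuous (Broken.toHat (P := P) (v := v) (w := w)) := continuous_induced_dom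
    refine continuous_pi fun c => ?_
    have h1 : Continuous fun γ : P.Broken v w => pathPoint v γ.toHat (c.1 - ε c.1) :=
      ((continuous_apply _).comp (continuous_snd.comp hE)).comp hι
    refine h1.congr fun γ => ?_
    rw [pathPoint_of_le (p := γ.toHat) (hlev c.1 c.2.1 c.2.2.1), γ.hatTrace_toHat]
    rfl

end MorseSmalePair

/-! ### Properness and the choice of `ε` and `δ` -/

theorem FlowConn.map_left {M : Type*} [TopologicalSpace M] {φ : Flow ℝ M} {x y : M}
    (H : FlowConn φ x y) (t : ℝ) : FlowConn φ (φ t x) y := by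
  rcases H with ⟨s, rfl⟩ | H | H
  · exact .inl ⟨s - t, by rw [← φ.map_add, sub_add_cancel]⟩
  · refine .inr (.inl ?_)
    simp_rw [← φ.map_add]
    exact H.comp (tendsto_atTop_add_const_right _ t tendsto_id)
  · refine .inr (.inr ?_)
    simp_rw [← φ.map_add]
    exact H.comp (tendsto_atBot_add_const_right _ t tendsto_id)

namespace MorseSmalePair

universe u

variable {n : ℕ} {M : Type u} [TopologicalSpace M] [ChartedSpace (Rn n) M]
  [IsManifold (𝓡 n) ∞ M] {P : MorseSmalePair n M} {v w : P.Crit} [T2Space M]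

theorem pathPoint_mem_hatTrace (p : P.Hat v) (s : ℝ) : pathPoint v p s ∈ hatTrace v p := by
  rcases le_total s v.val with hs | hs
  · exact (pathPoint_spec hs).1
  · rw [pathPoint_eq_top hs]
    exact left_mem_hatTrace p

theorem exists_gap_below (P : MorseSmalePair n M) (a : ℝ) :
    ∃ lo < a, ∀ c ∈ P.critValues, lo < c → a ≤ c := by
  -- The value `a - 1` is a default, so that a maximum exists even if no critical value is close
  -- below `a`.
  have hfin : (insert (a - 1) (P.critValues ∩ Ico (a - 1) a)).Finite :=
    ((P.critSet_levels_finite (a - 1) a).subset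
      (inter_subset_inter_right _ Ico_subset_Icc_self)).insert _
  obtain ⟨lo, hlo, hmax⟩ := Set.exists_max_image _ id hfin ⟨_, mem_insert _ _⟩
  refine ⟨lo, ?_, fun c hc hlc => not_lt.1 fun hca => ?_⟩
  · rcases hlo with rfl | hlo
    · exact sub_one_lt a
    · exact hlo.2.2
  · exact absurd (hmax c (.inr ⟨hc, (hmax _ (mem_insert _ _)).trans hlc.le, hca⟩)) (not_le.2 hlc)

/-- The trajectories of an ultrafilter whose end points converge converge pointwise. -/
theorem exists_tendsto_pathPoint {U : Ultrafilter (P.Hat v)} {y : M}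
    (hy : Tendsto (hatI v) U (𝓝 y)) (s : ℝ) :
    ∃ z, Tendsto (fun p => pathPoint v p s) U (𝓝 z) := by
  have hH : Tendsto (hatH v) U (𝓝 (P.h y)) := (P.isLyapunov.cont.tendsto y).comp hy
  have hmem : ∀ᶠ p in (U : Filter (P.Hat v)),
      pathPoint v p s ∈ P.h ⁻¹' Icc (P.h y - 1) v.val := by
    filter_upwards [hH.eventually (lt_mem_nhds (sub_one_lt _))] with p hp
    have h1 := pathPoint_mem_hatTrace p s
    exact ⟨hp.le.trans (hatH_le_of_mem_hatTrace h1), le_val_of_mem_hatTrace h1⟩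
  obtain ⟨z, -, hz⟩ := (P.isLyapunov.compact (P.h y - 1) v.val).ultrafilter_le_nhds
    (U.map fun p => pathPoint v p s) (le_principal_iff.2 hmem)
  exact ⟨z, hz⟩

/-- If the end points converge, then so do the points of the trajectories on the limiting level. -/
theorem tendsto_pathPoint_level {U : Ultrafilter (P.Hat v)} {y : M}
    (hy : Tendsto (hatI v) U (𝓝 y)) :
    Tendsto (fun p => pathPoint v p (P.h y)) U (𝓝 y) := by
  have hH : Tendsto (hatH v) U (𝓝 (P.h y)) := (P.isLyapunov.cont.tendsto y).comp hy
  have hav : P.h y ≤ v.val := le_of_tendsto hH (.of_forall hatH_le_val)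
  by_cases hlt : ∀ᶠ p in (U : Filter (P.Hat v)), P.h y ≤ hatH v p
  · exact hy.congr' (hlt.mono fun p hp => (pathPoint_of_ge hp).symm)
  replace hlt : ∀ᶠ p in (U : Filter (P.Hat v)), hatH v p < P.h y := by
    simpa only [not_le] using Ultrafilter.eventually_not.2 hlt
  -- If the end points approach from below, the level of `y` may be critical. A comparison is made
  -- on a regular level `q` just below it, on the full orbit of the end point, possibly past where
  -- the trace stops.
  obtain ⟨lo, hlo, hgap⟩ := P.exists_gap_below (P.h y)
  obtain ⟨q, hq1, hq2⟩ := exists_between hlo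
  have hlo' := hH.eventually (lt_mem_nhds hlo)
  have hadj : ∀ᶠ p in (U : Filter (P.Hat v)), ∀ r ∈ Icc lo (P.h y),
      LevelAdj P.h P.critSet (hatI v p) r := by
    filter_upwards [hlt, hlo'] with p h1 h2 r hr
    exact levelAdj_of_gap hgap h2 h1 hr
  have hz : ∀ᶠ p in (U : Filter (P.Hat v)), ∃ t, P.h (P.phi t (hatI v p)) = q := by
    filter_upwards [hadj] with p hp
    obtain ⟨z, hz, hzq⟩ := P.isLyapunov.exists_conn (hp q ⟨hq1.le, hq2.le⟩)
    obtain ⟨t, rfl⟩ := P.isLyapunov.orbit_of_conn hz fun hC =>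
      absurd (hgap _ ⟨z, hC, rfl⟩ (hzq.symm ▸ hq1)) (not_le.2 (hzq.symm ▸ hq2))
    exact ⟨t, hzq⟩
  obtain ⟨t, ht⟩ := hz.choice
  obtain ⟨z₀, -, hz₀⟩ := (P.isLyapunov.compact q q).ultrafilter_le_nhds
    (U.map fun p => P.phi (t p) (hatI v p))
    (le_principal_iff.2 (ht.mono fun p hp => ⟨hp.ge, hp.le⟩))
  replace hz₀ : Tendsto (fun p => P.phi (t p) (hatI v p)) U (𝓝 z₀) := hz₀
  have hz₀q : P.h z₀ = q := tendsto_nhds_unique ((P.isLyapunov.cont.tendsto z₀).comp hz₀)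
    (tendsto_const_nhds.congr' (ht.mono fun p hp => hp.symm))
  have hadj₀ : ∀ z, P.h z = q → ∀ r ∈ Icc lo (P.h y), LevelAdj P.h P.critSet z r :=
    fun z hz r hr => levelAdj_of_gap hgap (by rwa [hz]) (by rwa [hz]) hr
  have hay : P.h y ∈ Icc lo (P.h y) := ⟨hlo.le, le_rfl⟩
  obtain ⟨y', hy', hy'h⟩ := P.isLyapunov.exists_conn (hadj₀ z₀ hz₀q _ hay)
  have hC := (hadj₀ z₀ hz₀q _ hay).notMem
  -- The end points and the points on the level of `y` are both linked to the same points on level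
  -- `q`, and their levels both tend to `h y`. So both tend to the point `y'` linked to `z₀`, and
  -- `y' = y`.
  have h1 : Tendsto (hatI v) U (𝓝 y') := by
    refine P.isLyapunov.tendsto_of_conn hz₀ (.of_forall fun p => (FlowConn.refl _ _).map_left _)
      ?_ (hy'h ▸ hH) hC hy'
    filter_upwards [ht, hlt, hlo'] with p h1 h2 h3
    exact hadj₀ _ h1 _ ⟨h3.le, h2.le⟩
  have hlev : ∀ᶠ p in (U : Filter (P.Hat v)), P.h (pathPoint v p (P.h y)) = P.h y :=
    hlt.mono fun p hp => by rw [(pathPoint_spec hav).2, max_eq_left hp.le]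
  rw [tendsto_nhds_unique hy h1]
  have h2 : P.h y' = P.h y := hy'h
  rw [h2]
  refine P.isLyapunov.tendsto_of_conn hz₀ ?_ ?_ ?_ hC hy'
  · filter_upwards [hadj, hlev] with p h3 h4
    exact (conn_of_mem_hatTrace (hatI_mem_hatTrace p) (pathPoint_mem_hatTrace p _)
      (h4.symm ▸ h3 _ hay)).map_left _
  · filter_upwards [ht, hlev] with p h3 h4
    rw [h4]
    exact hadj₀ _ h3 _ hay
  · rw [h2]
    exact tendsto_const_nhds.congr' (hlev.mono fun p hp => hp.symm)

theorem isProperMap_hatI (v : P.Crit) :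
    @IsProperMap (P.Hat v) M (pathTopology v) _ (hatI v) := by
  let := pathTopology v
  refine isProperMap_iff_ultrafilter.2 ⟨continuous_hatI v, fun U y hy => ?_⟩
  have hH : Tendsto (hatH v) U (𝓝 (P.h y)) := (P.isLyapunov.cont.tendsto y).comp hy
  have hav : P.h y ≤ v.val := le_of_tendsto hH (.of_forall hatH_le_val)
  choose g hg using exists_tendsto_pathPoint hy
  have hgh : ∀ s ∈ Icc (P.h y) v.val, P.h (g s) = s := fun s hs => by
    have h1 : Tendsto (fun p => max s (hatH v p)) U (𝓝 (max s (P.h y))) :=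
      tendsto_const_nhds.max hH
    rw [max_eq_left hs.1] at h1
    refine tendsto_nhds_unique ((P.isLyapunov.cont.tendsto _).comp (hg s)) (h1.congr fun p => ?_)
    exact (pathPoint_spec hs.2).2.symm
  have hgv : g v.val = v.1 := tendsto_nhds_unique (hg _)
    (tendsto_const_nhds.congr fun p => (pathPoint_eq_top le_rfl).symm)
  have hgy : g (P.h y) = y := tendsto_nhds_unique (hg _) (tendsto_pathPoint_level hy)
  have hconn : ∀ s ∈ Icc (P.h y) v.val, ∀ r ∈ Icc (P.h y) v.val,
      LevelAdj P.h P.critSet (g r) s → FlowConn P.phi (g r) (g s) := fun s hs r hr hadj => by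
    have hσ : Tendsto (fun p => max s (hatH v p)) U (𝓝 s) := by
      simpa only [max_eq_left hs.1] using (tendsto_const_nhds (x := s)).max hH
    have hx : Tendsto (fun p => P.h (pathPoint v p r)) U (𝓝 (P.h (g r))) :=
      (P.isLyapunov.cont.tendsto _).comp (hg r)
    -- Adjacency in the limit persists along the ultrafilter provided the level is not pushed past
    -- `s`. The maximum never goes below `s`, and for `r < s` it eventually equals `s`.
    have hev : ∀ᶠ p in (U : Filter (P.Hat v)),
        LevelAdj P.h P.critSet (pathPoint v p r) (max s (hatH v p)) := by
      refine P.isLyapunov.eventually_levelAdj hx hσ hadj ?_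
        (.of_forall fun p _ => le_max_left _ _)
      rw [hgh r hr]
      rcases le_or_gt s r with h1 | h1
      · exact .of_forall fun p h => absurd h (not_lt.2 h1)
      · filter_upwards [hH.eventually (gt_mem_nhds (hr.1.trans_lt h1))] with p hp _
        exact (max_eq_left hp.le).le
    have hlev : ∀ p : P.Hat v, P.h (pathPoint v p s) = max s (hatH v p) :=
      fun p => (pathPoint_spec hs.2).2
    -- The points on level `s` converge to the point `z` linked to `g r`; uniqueness of limits
    -- identifies `z` with `g s`.
    obtain ⟨z, hz, hzs⟩ := P.isLyapunov.exists_conn hadj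
    have h1 : Tendsto (fun p => pathPoint v p s) U (𝓝 z) := by
      refine P.isLyapunov.tendsto_of_conn (hg r) ?_ ?_ ?_ hadj.notMem hz
      · filter_upwards [hev] with p hp
        exact conn_of_mem_hatTrace (pathPoint_mem_hatTrace p r) (pathPoint_mem_hatTrace p s)
          ((hlev p).symm ▸ hp)
      · simpa only [hlev] using hev
      · simpa only [hlev, hzs] using hσ
    rwa [tendsto_nhds_unique (hg s) h1]
  obtain ⟨p, hpI, hpT⟩ := exists_hat_of_conn hgh hgv hconn hav
  rw [hgy] at hpI
  have hpH : hatH v p = P.h y := congrArg P.h hpI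
  refine ⟨p, hpI, ?_⟩
  rw [nhds_induced, ← tendsto_iff_comap]
  refine Tendsto.prodMk_nhds (hpI.symm ▸ hy) (tendsto_pi_nhds.2 fun s => ?_)
  rcases lt_or_ge s (P.h y) with h1 | h1
  · rw [pathPoint_of_ge (hpH ▸ h1.le), hpI]
    refine hy.congr' ?_
    filter_upwards [hH.eventually (lt_mem_nhds h1)] with p' hp'
    exact (pathPoint_of_ge hp'.le).symm
  rcases le_total s v.val with h2 | h2
  · rw [pathPoint_of_le (hpH ▸ h1), pointAt_eq_of_mem (hpT s ⟨h1, h2⟩) (hgh s ⟨h1, h2⟩)]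
    exact hg s
  · simp only [pathPoint_eq_top h2]
    exact tendsto_const_nhds

theorem isCompact_hatI_preimage (w : P.Crit) :
    @IsCompact (P.Hat v) (pathTopology v) (hatI v ⁻¹' {w.1}) :=
  let _ := pathTopology v
  (isProperMap_hatI v).isCompact_preimage isCompact_singleton

theorem exists_admissible (P : MorseSmalePair n M) : ∃ ε δ : ℝ → ℝ, P.Admissible ε δ := by
  have hgap : ∀ c : ℝ, ∃ g > 0, ∀ c' ∈ P.critValues, c' ≠ c → g ≤ |c - c'| := fun c => by
    have hfin : ((P.critValues ∩ Icc (c - 1) (c + 1)) \ {c}).Finite :=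
      (P.critSet_levels_finite _ _).subset sdiff_subset
    obtain ⟨g, hg, hgs⟩ := Metric.mem_nhds_iff.1
      (hfin.isClosed.isOpen_compl.mem_nhds (fun h : c ∈ _ => h.2 rfl))
    refine ⟨min g 1, lt_min hg one_pos, fun c' hc' hne => ?_⟩
    by_contra! h
    obtain ⟨h1, h2⟩ := abs_lt.1 (h.trans_le (min_le_right _ _))
    refine hgs (show c' ∈ Metric.ball c g from ?_) ⟨⟨hc', by linarith, by linarith⟩, hne⟩
    rw [Metric.mem_ball, dist_comm, Real.dist_eq]
    exact h.trans_le (min_le_left _ _)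
  choose g hg0 hg using hgap
  -- A third of the smaller of the gaps at `c` and at its predecessor, if there is one. With `δ = g
  -- / 3` this gives the gap condition on `ε` and also `ε c ≤ δ c'`.
  have hε : ∀ c : ℝ, ∃ e > 0, e ≤ g c / 3 ∧ ∀ c' ∈ P.critValues, c' < c →
      (∀ c'' ∈ P.critValues, ¬ (c' < c'' ∧ c'' < c)) → e ≤ g c' / 3 := fun c => by
    by_cases hex : ∃ b ∈ P.critValues, b < c ∧ ∀ c'' ∈ P.critValues, ¬ (b < c'' ∧ c'' < c)
    · obtain ⟨b, hb, hbc, hbmax⟩ := hex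
      refine ⟨min (g c / 3) (g b / 3), lt_min (by linarith [hg0 c]) (by linarith [hg0 b]),
        min_le_left _ _, fun c' hc' hlt hmax => ?_⟩
      obtain rfl : c' = b := le_antisymm (not_lt.1 fun h => hbmax c' hc' ⟨h, hlt⟩)
        (not_lt.1 fun h => hmax b hb ⟨h, hbc⟩)
      exact min_le_right _ _
    · exact ⟨g c / 3, by linarith [hg0 c], le_rfl,
        fun c' hc' hlt hmax => absurd ⟨c', hc', hlt, hmax⟩ hex⟩
  choose e he0 he1 he2 using hε
  refine ⟨e, fun c => g c / 3, fun c hc => ⟨he0 c, fun c' hc' hlt => ?_⟩,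
    fun c hc => ⟨by linarith [hg0 c], fun c' hc' hne => ?_⟩, fun c _ => he2 c⟩
  · have h1 := hg c c' hc' hlt.ne
    rw [abs_of_pos (sub_pos.2 hlt)] at h1
    linarith [he1 c, hg0 c]
  · linarith [hg c c' hc' hne, hg0 c]

theorem compactSpace_t2Space_broken (v w : P.Crit) :
    @CompactSpace (P.Broken v w) (.induced Broken.toHat (pathTopology v)) ∧
      @T2Space (P.Broken v w) (.induced Broken.toHat (pathTopology v)) := by
  let := pathTopology v
  let : TopologicalSpace (P.Broken v w) := .induced Broken.toHat (pathTopology v)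
  have hι : IsInducing (Broken.toHat (P := P) (v := v) (w := w)) := ⟨rfl⟩
  have := t2Space_pathTopology v
  refine ⟨⟨hι.isCompact_iff.2 ?_⟩, (IsEmbedding.mk hι Broken.toHat_injective).t2Space⟩
  rw [image_univ, range_toHat]
  exact isCompact_hatI_preimage w

end MorseSmalePair
end

theorem theorem3p3 {n : ℕ} {M : Type*} [TopologicalSpace M] [T2Space M]
    [ChartedSpace (Rn n) M] [IsManifold (𝓡 n) ∞ M] (P : MorseSmalePair n M) :
    -- the choices that enter the definition of the topologies exist
    (∃ ε δ : ℝ → ℝ, P.Admissible ε δ) ∧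
    -- spaces of broken trajectories
    (∀ v w : P.Crit, w.Below v →
      (∀ ε ε' : ℝ → ℝ, P.AdmissibleEps ε → P.AdmissibleEps ε' →
        MorseSmalePair.brokenTopology ε v w = MorseSmalePair.brokenTopology ε' v w) ∧
      ∀ ε : ℝ → ℝ, P.AdmissibleEps ε →
        @CompactSpace (P.Broken v w) (MorseSmalePair.brokenTopology ε v w) ∧
        @T2Space (P.Broken v w) (MorseSmalePair.brokenTopology ε v w)) ∧
    -- completed unstable manifolds
    (∀ v : P.Crit,
      (∀ ε δ ε' δ' : ℝ → ℝ, P.Admissible ε δ → P.Admissible ε' δ' →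
        MorseSmalePair.hatTopology ε δ v = MorseSmalePair.hatTopology ε' δ' v) ∧
      ∀ ε δ : ℝ → ℝ, P.Admissible ε δ →
        @T2Space (P.Hat v) (MorseSmalePair.hatTopology ε δ v) ∧
        @IsProperMap (P.Hat v) M (MorseSmalePair.hatTopology ε δ v) inferInstance
          (MorseSmalePair.hatI v) ∧
        @IsProperMap (P.Hat v) ℝ (MorseSmalePair.hatTopology ε δ v) inferInstance
          (MorseSmalePair.hatH v) ∧
        (CompactSpace M → @CompactSpace (P.Hat v) (MorseSmalePair.hatTopology ε δ v))) := by
  refine ⟨P.exists_admissible, fun v w _ => ⟨fun ε ε' hε hε' => ?_, fun ε hε => ?_⟩,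
    fun v => ⟨fun ε δ ε' δ' h h' => ?_, fun ε δ h => ?_⟩⟩
  · rw [MorseSmalePair.brokenTopology_eq hε, MorseSmalePair.brokenTopology_eq hε']
  · rw [MorseSmalePair.brokenTopology_eq hε]
    exact MorseSmalePair.compactSpace_t2Space_broken v w
  · rw [MorseSmalePair.hatTopology_eq h, MorseSmalePair.hatTopology_eq h']
  · rw [MorseSmalePair.hatTopology_eq h]
    let := MorseSmalePair.pathTopology v
    have hI := MorseSmalePair.isProperMap_hatI v
    -- `hatH` is by definition `P.h ∘ hatI v`, a composite of proper maps.
    exact ⟨MorseSmalePair.t2Space_pathTopology v, hI, P.proper_h.comp hI,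
      fun _ => ⟨by simpa using hI.isCompact_preimage isCompact_univ⟩⟩
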